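/- Maximum Bipartite Subgraph (MBS) on unit disks is the following problem. Given the centres of $n$ closed unit disks $D_1,\dots,D_n$ in the plane, find a largest index set $S\subseteq\{1,\dots,n\}$ such that the intersection graph of $\{D_i : i\in S\}$ (vertices $i\in S$, and an edge between $i\neq j$ whenever $D_i\cap D_j\neq\emptyset$) is bipartite. Let $\mathrm{OPT}$ denote the maximum size of such a set. Theorem. MBS on unit disks has a PTAS running in time $O(n^{O(1)}\cdot n^{O(1/\varepsilon)})$. That is, there are a single real-RAM algorithm and constants $C,a,b\in\mathbb N$ (independent of $\varepsilon$ and of the input) such that for every real $\varepsilon>0$, every $n$, and every $n$ unit disks in the plane, given as input $\varepsilon$, $n$ and the coordinates of the centres, the algorithm halts after at most $C\cdot m^{a}\cdot m^{b/\varepsilon}$ steps, where $m=\max(n,1)$, and returns a set $S$ of disks whose intersection graph is bipartite and which satisfies $\mathrm{OPT}\le(1+\varepsilon)\,|S|$. Here the real RAM performs, at unit cost, exact addition, subtraction, multiplication and comparison of reals, addition, (truncated) subtraction and comparison of natural numbers, array access with computed natural-number indices, and branching; only integer constants may be used, and there is no rounding operation. -/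

import Mathlib

/-! ### A real RAM with a step count

Programs work on natural-number variables and arrays (used for indices, counters and flags) and on
real variables and arrays.  Names of variables and arrays are natural numbers fixed in the program
text; array cells are addressed by computed natural numbers.

Every operation costs one step.  Natural numbers have addition, truncated subtraction and
comparison (no multiplication).  Reals have exact addition, subtraction, multiplication and
comparison; the only literals are integers, and there is no rounding and no way to turn a real into
a natural number other than by branching on comparisons. -/

namespace RealRAM

/-- Expressions with values in the natural numbers. -/
inductive NExpr : Type
  | lit (k : ℕ)
  | var (x : ℕ)
  | cell (A : ℕ) (i : NExpr)
  | add (e f : NExpr)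
  | sub (e f : NExpr)

/-- Expressions with values in the real numbers. -/
inductive RExpr : Type
  | lit (k : ℤ)
  | var (x : ℕ)
  | cell (A : ℕ) (i : NExpr)
  | add (e f : RExpr)
  | sub (e f : RExpr)
  | mul (e f : RExpr)

/-- Tests. -/
inductive Test : Type
  | nle (e f : NExpr)
  | rle (e f : RExpr)
  | not (b : Test)
  | and (b c : Test)

/-- Programs. -/
inductive Prog : Type
  | skip
  | setN (x : ℕ) (e : NExpr)
  | setNCell (A : ℕ) (i e : NExpr)
  | setR (x : ℕ) (e : RExpr)
  | setRCell (A : ℕ) (i : NExpr) (e : RExpr)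
  | seq (p q : Prog)
  | cond (b : Test) (p q : Prog)
  | loop (b : Test) (p : Prog)

/-- Contents of the memory. -/
@[ext]
structure State : Type where
  nvar : ℕ → ℕ
  narr : ℕ → ℕ → ℕ
  rvar : ℕ → ℝ
  rarr : ℕ → ℕ → ℝ

namespace NExpr

/-- Value of an expression. -/
def eval (σ : State) : NExpr → ℕ
  | lit k => k
  | var x => σ.nvar x
  | cell A i => σ.narr A (i.eval σ)
  | add e f => e.eval σ + f.eval σ
  | sub e f => e.eval σ - f.eval σ

/-- Number of steps needed to evaluate an expression: the number of its nodes. -/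
def cost : NExpr → ℕ
  | lit _ => 1
  | var _ => 1
  | cell _ i => i.cost + 1
  | add e f => e.cost + f.cost + 1
  | sub e f => e.cost + f.cost + 1

end NExpr

namespace RExpr

/-- Value of an expression. -/
noncomputable def eval (σ : State) : RExpr → ℝ
  | lit k => (k : ℝ)
  | var x => σ.rvar x
  | cell A i => σ.rarr A (i.eval σ)
  | add e f => e.eval σ + f.eval σ
  | sub e f => e.eval σ - f.eval σ
  | mul e f => e.eval σ * f.eval σ

/-- Number of steps needed to evaluate an expression: the number of its nodes. -/
def cost : RExpr → ℕ
  | lit _ => 1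
  | var _ => 1
  | cell _ i => i.cost + 1
  | add e f => e.cost + f.cost + 1
  | sub e f => e.cost + f.cost + 1
  | mul e f => e.cost + f.cost + 1

end RExpr

namespace Test

/-- Truth of a test. -/
def holds (σ : State) : Test → Prop
  | nle e f => e.eval σ ≤ f.eval σ
  | rle e f => e.eval σ ≤ f.eval σ
  | not b => ¬ b.holds σ
  | and b c => b.holds σ ∧ c.holds σ

/-- Number of steps needed to evaluate a test: the number of its nodes. -/
def cost : Test → ℕ
  | nle e f => e.cost + f.cost + 1
  | rle e f => e.cost + f.cost + 1
  | not b => b.cost + 1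
  | and b c => b.cost + c.cost + 1

end Test

namespace State

/-- Assignment to a natural-number variable. -/
def setN (σ : State) (x v : ℕ) : State :=
  { σ with nvar := Function.update σ.nvar x v }

/-- Assignment to a cell of a natural-number array. -/
def setNCell (σ : State) (A i v : ℕ) : State :=
  { σ with narr := Function.update σ.narr A (Function.update (σ.narr A) i v) }

/-- Assignment to a real variable. -/
noncomputable def setR (σ : State) (x : ℕ) (v : ℝ) : State :=
  { σ with rvar := Function.update σ.rvar x v }

/-- Assignment to a cell of a real array. -/
noncomputable def setRCell (σ : State) (A i : ℕ) (v : ℝ) : State :=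
  { σ with rarr := Function.update σ.rarr A (Function.update (σ.rarr A) i v) }

end State

/-- `Exec p σ τ t`: started in memory `σ`, the program `p` halts after exactly `t` steps and leaves
memory `τ`. -/
inductive Exec : Prog → State → State → ℕ → Prop
  | skip (σ : State) : Exec .skip σ σ 1
  | setN (σ : State) (x : ℕ) (e : NExpr) :
      Exec (.setN x e) σ (σ.setN x (e.eval σ)) (e.cost + 1)
  | setNCell (σ : State) (A : ℕ) (i e : NExpr) :
      Exec (.setNCell A i e) σ (σ.setNCell A (i.eval σ) (e.eval σ)) (i.cost + e.cost + 1)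
  | setR (σ : State) (x : ℕ) (e : RExpr) :
      Exec (.setR x e) σ (σ.setR x (e.eval σ)) (e.cost + 1)
  | setRCell (σ : State) (A : ℕ) (i : NExpr) (e : RExpr) :
      Exec (.setRCell A i e) σ (σ.setRCell A (i.eval σ) (e.eval σ)) (i.cost + e.cost + 1)
  | seq {p q : Prog} {σ τ υ : State} {s t : ℕ} (hp : Exec p σ τ s) (hq : Exec q τ υ t) :
      Exec (.seq p q) σ υ (s + t)
  | cond_true {b : Test} {p q : Prog} {σ τ : State} {t : ℕ} (hb : b.holds σ)
      (hp : Exec p σ τ t) : Exec (.cond b p q) σ τ (b.cost + t + 1)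
  | cond_false {b : Test} {p q : Prog} {σ τ : State} {t : ℕ} (hb : ¬ b.holds σ)
      (hq : Exec q σ τ t) : Exec (.cond b p q) σ τ (b.cost + t + 1)
  | loop_false {b : Test} {p : Prog} {σ : State} (hb : ¬ b.holds σ) :
      Exec (.loop b p) σ σ (b.cost + 1)
  | loop_true {b : Test} {p : Prog} {σ τ υ : State} {s t : ℕ} (hb : b.holds σ)
      (hp : Exec p σ τ s) (hl : Exec (.loop b p) τ υ t) :
      Exec (.loop b p) σ υ (b.cost + s + t + 1)

/-- Programs are deterministic: the final memory and the number of steps are determined by the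
initial memory. -/
theorem Exec.deterministic {p : Prog} {σ τ τ' : State} {t t' : ℕ} (h : Exec p σ τ t)
    (h' : Exec p σ τ' t') : τ = τ' ∧ t = t' := by
  induction h generalizing τ' t' with
  | skip | setN | setNCell | setR | setRCell => cases h'; exact ⟨rfl, rfl⟩
  | seq _ _ ihp ihq =>
    cases h' with
    | seq hp' hq' =>
      obtain ⟨rfl, rfl⟩ := ihp hp'
      obtain ⟨rfl, rfl⟩ := ihq hq'
      exact ⟨rfl, rfl⟩
  | cond_true hb _ ih =>
    cases h' with
    | cond_true _ hp' => obtain ⟨rfl, rfl⟩ := ih hp'; exact ⟨rfl, rfl⟩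
    | cond_false hb' _ => exact absurd hb hb'
  | cond_false hb _ ih =>
    cases h' with
    | cond_true hb' _ => exact absurd hb' hb
    | cond_false _ hq' => obtain ⟨rfl, rfl⟩ := ih hq'; exact ⟨rfl, rfl⟩
  | loop_false hb =>
    cases h' with
    | loop_false _ => exact ⟨rfl, rfl⟩
    | loop_true hb' _ _ => exact absurd hb' hb
  | loop_true hb _ _ ihp ihl =>
    cases h' with
    | loop_false hb' => exact absurd hb hb'
    | loop_true _ hp' hl' =>
      obtain ⟨rfl, rfl⟩ := ihp hp'
      obtain ⟨rfl, rfl⟩ := ihl hl'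
      exact ⟨rfl, rfl⟩

end RealRAM

/-! ### The maximum bipartite subgraph problem on unit disks -/

namespace MBS

/-- The intersection graph of a family of sets. -/
def intersectionGraph {ι X : Type*} (D : ι → Set X) : SimpleGraph ι where
  Adj i j := i ≠ j ∧ (D i ∩ D j).Nonempty
  symm := ⟨fun _ _ h => ⟨h.1.symm, by rw [Set.inter_comm]; exact h.2⟩⟩
  loopless := ⟨fun _ h => h.1 rfl⟩

/-- The closed unit disk with a given centre. -/
def unitDisk (p : EuclideanSpace ℝ (Fin 2)) : Set (EuclideanSpace ℝ (Fin 2)) :=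
  Metric.closedBall p 1

/-- Feasible solutions: the chosen unit disks induce a bipartite intersection graph. -/
def IsFeasible {n : ℕ} (c : Fin n → EuclideanSpace ℝ (Fin 2)) (S : Finset (Fin n)) : Prop :=
  ((intersectionGraph fun i => unitDisk (c i)).induce (S : Set (Fin n))).IsBipartite

/-- `S` is an `α`-approximate solution: it is feasible, and no feasible solution has more than
`α * |S|` disks. -/
def IsApprox {n : ℕ} (c : Fin n → EuclideanSpace ℝ (Fin 2)) (α : ℝ) (S : Finset (Fin n)) : Prop :=
  IsFeasible c S ∧ ∀ T : Finset (Fin n), IsFeasible c T → (T.card : ℝ) ≤ α * (S.card : ℝ)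

/-- Initial memory: the number `n` of disks in natural-number variable `0`, the accuracy `ε` in
real variable `0`, the two coordinates of the `i`-th centre in cell `i` of the real arrays `0` and
`1`, and zeros everywhere else. -/
noncomputable def input (ε : ℝ) {n : ℕ} (c : Fin n → EuclideanSpace ℝ (Fin 2)) :
    RealRAM.State where
  nvar x := if x = 0 then n else 0
  narr _ _ := 0
  rvar x := if x = 0 then ε else 0
  rarr A i :=
    if h : i < n then (if A = 0 then c ⟨i, h⟩ 0 else if A = 1 then c ⟨i, h⟩ 1 else 0) else 0

/-- The set of disks returned by a program: the `i`-th disk is chosen when cell `i` of the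
natural-number array `0` is nonzero. -/
def output (n : ℕ) (τ : RealRAM.State) : Finset (Fin n) :=
  Finset.univ.filter fun i => τ.narr 0 i ≠ 0

end MBS

/-! Shifting in one direction suffices. Put `K = ⌈1/ε⌉` and cut the plane into horizontal rows of
height 2. For some residue modulo `K + 1`, deleting the points in the rows of that residue costs an
optimal solution at most a `1/(K+1)` fraction. The rest falls into groups of height at most `2K`,
more than 2 apart (`exists_grouping`), so disks of different groups never meet.

Read what remains group by group upwards, and from left to right inside a group. Each item is a
record: a point, one of two colours, and the lowest and highest points of its group. There are `2n³`
records. The decisive fact (`Table.pairwise_compatible`) is that consistency with the preceding `w =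
18K + 1` records forces global consistency. An earlier conflicting record of the same strip would be
within horizontal distance 2, so the `w` records in between would lie in a box of size `2 × 2K`,
where packing allows at most `12K + 6` compatible records.

Hence a longest window-valid list solves the problem up to the factor `1 + 1/K ≤ 1 + ε`. Whether a
list can be extended depends only on its last `w` records, so a breadth-first search may keep one
list for each length and window (`Entries.Search`). This leaves at most `(n + 1)(V + 1)^w` entries
with `V = 2n³`, which is `n^O(1/ε)` for `n ≥ 2`. Completeness is `exists_windowValid` with
`Search.exists_entry`; soundness is `isFeasible_of_windowValid`. The rest implements the search on
the RAM and counts steps. -/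

namespace MBS

/-! ### Lists constrained only within a sliding window. -/

/-- A list, newest element first, in which every element satisfies `G` and is related by `R` to
each of the `w` elements that were added before it. -/
def WindowValid {ρ : Type*} (G : ρ → Prop) (R : ρ → ρ → Prop) (w : ℕ) : List ρ → Prop
  | [] => True
  | r :: l => G r ∧ (∀ s ∈ l.take w, R s r) ∧ WindowValid G R w l

theorem WindowValid.forall_mem {ρ : Type*} {G : ρ → Prop} {R : ρ → ρ → Prop} {w : ℕ} :
    ∀ {l : List ρ}, WindowValid G R w l → ∀ r ∈ l, G r
  | [], _, r, hr => by simp at hr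
  | a :: l, h, r, hr => by
    rcases List.mem_cons.1 hr with rfl | hr
    · exact h.1
    · exact h.2.2.forall_mem r hr

theorem windowValid_of_pairwise {ρ : Type*} {G : ρ → Prop} {R : ρ → ρ → Prop} {w : ℕ} :
    ∀ {l : List ρ}, (∀ r ∈ l, G r) → l.Pairwise (fun r s => R s r) → WindowValid G R w l
  | [], _, _ => trivial
  | a :: l, hG, hR => by
    rw [List.pairwise_cons] at hR
    exact ⟨hG a (by simp), fun s hs => hR.1 s (List.mem_of_mem_take hs),
      windowValid_of_pairwise (fun r hr => hG r (by simp [hr])) hR.2⟩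

/-! ### Geometry of records: sweep order and packing. -/

/-- Points with coordinates `x`, `y`, and a table of records: a record names a point `I`, a colour
`C`, and a horizontal strip of height at most `2 * k` that reaches from the point `A` up to the
point `B`. -/
structure Table where
  x : ℕ → ℝ
  y : ℕ → ℝ
  I : ℕ → ℕ
  A : ℕ → ℕ
  B : ℕ → ℕ
  C : ℕ → ℕ
  k : ℝ

namespace Table

variable (D : Table)

/-- The point of the record lies in its strip, and the strip is not too high. -/
def Fit (r : ℕ) : Prop :=
  D.y (D.A r) ≤ D.y (D.I r) ∧ D.y (D.I r) ≤ D.y (D.B r) ∧ D.y (D.B r) ≤ D.y (D.A r) + 2 * D.k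

/-- Same colour, and the unit disks intersect. -/
def Clash (s r : ℕ) : Prop :=
  D.C s = D.C r ∧
    (D.x (D.I s) - D.x (D.I r)) * (D.x (D.I s) - D.x (D.I r)) +
      (D.y (D.I s) - D.y (D.I r)) * (D.y (D.I s) - D.y (D.I r)) ≤ 4

/-- The strip of `r` is above that of `s`, at distance more than `2`. -/
def Above (s r : ℕ) : Prop := D.y (D.B s) + 2 < D.y (D.A r)

/-- Same strip, and the point of `r` is not to the left of that of `s`. -/
def Right (s r : ℕ) : Prop :=
  D.A s = D.A r ∧ D.B s = D.B r ∧ D.x (D.I s) ≤ D.x (D.I r)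

/-- The record `r` may follow the record `s`. -/
def Prec (s r : ℕ) : Prop :=
  D.Above s r ∨ (D.Right s r ∧ D.I s ≠ D.I r ∧ ¬ D.Clash s r)

variable {D}

/-- Two vertical gaps add up because the middle strip has its bottom no higher than its top; this is
all that `Fit` is needed for. -/
theorem ord_trans {s t r : ℕ} (ht : D.Fit t)
    (h₁ : D.Above s t ∨ D.Right s t) (h₂ : D.Above t r ∨ D.Right t r) :
    D.Above s r ∨ D.Right s r := by
  obtain ⟨t1, t2, -⟩ := ht
  unfold Above Right at *
  rcases h₁ with h₁ | ⟨a, b, c⟩ <;> rcases h₂ with h₂ | ⟨a', b', c'⟩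
  · left; linarith
  · left; rw [← a']; exact h₁
  · left; rw [b]; exact h₂
  · right; exact ⟨a.trans a', b.trans b', c.trans c'⟩

/-- The sweep never descends: once it has left the strip of `s` upwards it cannot come back to the
bottom `A s = A r`. -/
theorem right_of_between {s t r : ℕ} (hs : D.Fit s) (ht : D.Fit t) (hsr : D.A s = D.A r)
    (h₁ : D.Above s t ∨ D.Right s t) (h₂ : D.Above t r ∨ D.Right t r) :
    D.Right s t ∧ D.Right t r := by
  obtain ⟨t1, t2, -⟩ := ht
  obtain ⟨s1, s2, -⟩ := hs
  unfold Above Right at *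
  rcases h₁ with h₁ | ⟨a, b, c⟩ <;> rcases h₂ with h₂ | ⟨a₂, b₂, c₂⟩
  · rw [← hsr] at h₂; linarith
  · rw [a₂, ← hsr] at h₁; linarith
  · rw [← hsr, ← b] at h₂; linarith
  · exact ⟨⟨a, b, c⟩, a₂, b₂, c₂⟩

/-- Pairwise compatible points in a box of width `2` and height `2 * K` are few. -/
theorem length_le_of_box {K : ℕ} {l : List ℕ} {X Y : ℝ}
    (hC : ∀ t ∈ l, D.C t < 2)
    (hx : ∀ t ∈ l, X ≤ D.x (D.I t) ∧ D.x (D.I t) ≤ X + 2)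
    (hy : ∀ t ∈ l, Y ≤ D.y (D.I t) ∧ D.y (D.I t) ≤ Y + 2 * K)
    (hl : l.Pairwise fun r s => ¬ D.Clash s r) : l.length ≤ 2 * (3 * (2 * K + 1)) := by
  classical
  -- Unit cells: two points in one cell are at squared distance at most 2, so equal colours would
  -- clash. The box is closed, which adds one cell per direction: 3 columns and `2 * K + 1` rows.
  let φ : ℕ → ℕ × ℕ × ℕ := fun t => (D.C t, ⌊D.x (D.I t) - X⌋₊, ⌊D.y (D.I t) - Y⌋₊)
  have hnd : (l.map φ).Nodup := by
    rw [List.Nodup, List.pairwise_map]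
    refine List.Pairwise.imp_of_mem ?_ hl
    intro r s hr hs hrs heq
    apply hrs
    simp only [φ, Prod.mk.injEq] at heq
    obtain ⟨h1, h2, h3⟩ := heq
    refine ⟨h1.symm, ?_⟩
    have a1 := Nat.floor_le (sub_nonneg.2 (hx r hr).1)
    have a2 := Nat.lt_floor_add_one (D.x (D.I r) - X)
    have a3 := Nat.floor_le (sub_nonneg.2 (hx s hs).1)
    have a4 := Nat.lt_floor_add_one (D.x (D.I s) - X)
    have b1 := Nat.floor_le (sub_nonneg.2 (hy r hr).1)
    have b2 := Nat.lt_floor_add_one (D.y (D.I r) - Y)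
    have b3 := Nat.floor_le (sub_nonneg.2 (hy s hs).1)
    have b4 := Nat.lt_floor_add_one (D.y (D.I s) - Y)
    rw [h2] at a1 a2
    rw [h3] at b1 b2
    have e1 : (D.x (D.I s) - D.x (D.I r)) * (D.x (D.I s) - D.x (D.I r)) ≤ 1 := by
      rw [← sq, sq_le_one_iff_abs_le_one, abs_le]; constructor <;> linarith
    have e2 : (D.y (D.I s) - D.y (D.I r)) * (D.y (D.I s) - D.y (D.I r)) ≤ 1 := by
      rw [← sq, sq_le_one_iff_abs_le_one, abs_le]; constructor <;> linarith
    linarith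
  have hsub : (l.map φ).toFinset ⊆
      Finset.range 2 ×ˢ (Finset.range 3 ×ˢ Finset.range (2 * K + 1)) := by
    intro p hp
    simp only [List.mem_toFinset, List.mem_map] at hp
    obtain ⟨t, ht, rfl⟩ := hp
    simp only [φ, Finset.mem_product, Finset.mem_range]
    refine ⟨hC t ht, ?_, ?_⟩
    · apply Nat.lt_succ_of_le
      apply Nat.floor_le_of_le
      push_cast; linarith [(hx t ht).2]
    · apply Nat.lt_succ_of_le
      apply Nat.floor_le_of_le
      push_cast; linarith [(hy t ht).2]
  have := Finset.card_le_card hsub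
  rw [List.toFinset_card_of_nodup hnd, List.length_map] at this
  simpa using this

/-- A nonempty window contains the immediate predecessor, and the order between neighbours
propagates by transitivity. -/
theorem pairwise_ord {w : ℕ} (hw : 1 ≤ w) :
    ∀ {l : List ℕ}, WindowValid D.Fit D.Prec w l →
      l.Pairwise fun r s => D.Above s r ∨ D.Right s r
  | [], _ => List.Pairwise.nil
  | [a], _ => List.pairwise_singleton _ _
  | r :: t :: l, h => by
    have ih := pairwise_ord hw h.2.2
    have htr : D.Above t r ∨ D.Right t r := by
      have : t ∈ (t :: l).take w := by
        obtain ⟨w, rfl⟩ := Nat.exists_eq_add_of_le' hw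
        simp
      exact (h.2.1 t this).imp id fun h => h.1
    refine List.pairwise_cons.2 ⟨?_, ih⟩
    intro s hs
    rcases List.mem_cons.1 hs with rfl | hs
    · exact htr
    · exact ord_trans h.2.2.1 ((List.pairwise_cons.1 ih).1 s hs) htr

/-- Compatibility within windows implies compatibility altogether. -/
theorem pairwise_compatible {w K : ℕ} (hk : D.k = K) (hw : 2 * (3 * (2 * K + 1)) < w) :
    ∀ {l : List ℕ}, (∀ t ∈ l, D.C t < 2) → WindowValid D.Fit D.Prec w l →
      l.Pairwise fun r s => D.I s ≠ D.I r ∧ ¬ D.Clash s r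
  | [], _, _ => List.Pairwise.nil
  | r :: l, hC, h => by
    have ih := pairwise_compatible hk hw (fun t ht => hC t (by simp [ht])) h.2.2
    have hord := pairwise_ord (by omega) h
    have hfit := h.forall_mem
    refine List.pairwise_cons.2 ⟨?_, ih⟩
    intro s hs
    have hfs := hfit s (by simp [hs])
    have hfr := hfit r (by simp)
    have hsr := (List.pairwise_cons.1 hord).1 s hs
    rcases hsr with hsr | hsr
    -- Different strips: the vertical distance alone exceeds 2.
    · have key : D.y (D.I s) + 2 < D.y (D.I r) := by
        have := hfs.2.1; have := hfr.1; unfold Above at hsr; linarith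
      refine ⟨fun h => ?_, fun h => ?_⟩
      · rw [h] at key; linarith
      · have := h.2
        nlinarith [mul_self_nonneg (D.x (D.I s) - D.x (D.I r))]
    -- Same strip and inside the window: `Prec` applies directly, since a strip is not above itself.
    by_cases hst : s ∈ l.take w
    · rcases h.2.1 s hst with h' | h'
      · have h1 := hsr.1; have h2 := hfs.1; have h3 := hfs.2.1; unfold Above at h'
        rw [← h1] at h'; linarith
      · exact h'.2
    have hsd : s ∈ l.drop w := by
      rw [← List.take_append_drop w l, List.mem_append] at hs
      exact hs.resolve_left hst
    have hlen : (l.take w).length = w := by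
      rw [List.length_take, min_eq_left]
      by_contra hlt
      rw [List.drop_eq_nil_of_le (by omega)] at hsd
      simp at hsd
    -- Beyond the window: a conflict puts `s` within horizontal distance 2 of `r`, so the whole
    -- window between them lies in one box and is too long for the packing bound.
    by_contra hcon
    have hclose : D.x (D.I r) ≤ D.x (D.I s) + 2 := by
      by_contra hfar
      push Not at hfar
      apply hcon
      refine ⟨fun h => by rw [h] at hfar; linarith, fun h => ?_⟩
      have := h.2
      nlinarith [mul_self_nonneg (D.y (D.I s) - D.y (D.I r))]
    have hbetween : ∀ t ∈ l.take w, D.Right s t ∧ D.Right t r := by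
      intro t ht
      have htl := List.mem_of_mem_take ht
      refine right_of_between hfs (hfit t (by simp [htl])) hsr.1 ?_
        ((List.pairwise_cons.1 hord).1 t htl)
      have h2 := (List.pairwise_cons.1 hord).2
      rw [← List.take_append_drop w l, List.pairwise_append] at h2
      exact h2.2.2 t ht s hsd
    have := length_le_of_box (D := D) (K := K) (l := l.take w) (X := D.x (D.I s))
      (Y := D.y (D.A s)) (fun t ht => hC t (by simp [List.mem_of_mem_take ht]))
      (fun t ht => ⟨(hbetween t ht).1.2.2, (hbetween t ht).2.2.2.trans hclose⟩)
      (fun t ht => by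
        have hf := hfit t (by simp [List.mem_of_mem_take ht])
        rw [(hbetween t ht).1.1, ← hk]
        exact ⟨hf.1, hf.2.1.trans hf.2.2⟩)
      ((ih.sublist (List.take_sublist w l)).imp fun h => h.2)
    omega

end Table

/-! ### From feasible sets to window-valid lists and back. -/

theorem unitDisk_inter_nonempty_iff (p q : EuclideanSpace ℝ (Fin 2)) :
    (unitDisk p ∩ unitDisk q).Nonempty ↔
      (p 0 - q 0) * (p 0 - q 0) + (p 1 - q 1) * (p 1 - q 1) ≤ 4 := by
  rw [← Set.not_disjoint_iff_nonempty_inter, unitDisk, unitDisk,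
    disjoint_closedBall_closedBall_iff zero_le_one zero_le_one, not_lt, EuclideanSpace.dist_eq,
    Fin.sum_univ_two, Real.sqrt_le_left (by norm_num), Real.dist_eq, Real.dist_eq, sq_abs, sq_abs,
    sq, sq]
  norm_num

/-- Conflicts become polynomial inequalities in the coordinates, the form that the RAM can test
without square roots. -/
theorem isFeasible_iff {n : ℕ} (c : Fin n → EuclideanSpace ℝ (Fin 2)) (S : Finset (Fin n)) :
    IsFeasible c S ↔ ∃ col : Fin n → Fin 2, ∀ i ∈ S, ∀ j ∈ S, i ≠ j →
      (c i 0 - c j 0) * (c i 0 - c j 0) + (c i 1 - c j 1) * (c i 1 - c j 1) ≤ 4 →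
        col i ≠ col j := by
  classical
  constructor
  · rintro ⟨col⟩
    refine ⟨fun i => if h : i ∈ S then col ⟨i, h⟩ else 0, fun i hi j hj hij hd => ?_⟩
    simp only [hi, hj, dif_pos]
    apply col.valid
    exact ⟨hij, (unitDisk_inter_nonempty_iff _ _).2 hd⟩
  · rintro ⟨col, h⟩
    refine ⟨SimpleGraph.Coloring.mk (fun i => col i) ?_⟩
    rintro ⟨i, hi⟩ ⟨j, hj⟩ hij
    exact h i hi j hj hij.1 ((unitDisk_inter_nonempty_iff _ _).1 hij.2)

/-- Some residue class modulo `K + 1` holds at most the average number of elements. -/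
theorem exists_sparse_residue {ι : Type*} (T : Finset ι) (ℓ : ι → ℤ) (K : ℕ) :
    ∃ ρ : ℤ, (K + 1) * (T.filter fun i => (ℓ i - ρ) % (K + 1) = 0).card ≤ T.card := by
  classical
  by_contra hcon
  push Not at hcon
  have hp : (0 : ℤ) < K + 1 := by positivity
  have hmap : ∀ i ∈ T, ℓ i % (K + 1) ∈ Finset.Ico (0 : ℤ) (K + 1) := fun i _ =>
    Finset.mem_Ico.2 ⟨Int.emod_nonneg _ hp.ne', Int.emod_lt_of_pos _ hp⟩
  have hsum := Finset.card_eq_sum_card_fiberwise hmap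
  have hlt : ∑ ρ ∈ Finset.Ico (0 : ℤ) (K + 1), T.card <
      ∑ ρ ∈ Finset.Ico (0 : ℤ) (K + 1),
        (K + 1) * (T.filter fun i => ℓ i % (K + 1) = ρ).card := by
    apply Finset.sum_lt_sum_of_nonempty
    · exact ⟨0, Finset.mem_Ico.2 ⟨le_rfl, hp⟩⟩
    · intro ρ hρ
      rw [Finset.mem_Ico] at hρ
      refine (hcon ρ).trans_le (Nat.mul_le_mul_left _ (Finset.card_le_card ?_))
      intro i hi
      rw [Finset.mem_filter] at hi ⊢
      refine ⟨hi.1, ?_⟩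
      rw [← Int.emod_eq_emod_iff_emod_sub_eq_zero] at hi
      rw [hi.2, Int.emod_eq_of_lt hρ.1 hρ.2]
  rw [← Finset.mul_sum, ← hsum, Finset.sum_const, Int.card_Ico, smul_eq_mul] at hlt
  have : ((K : ℤ) + 1 - 0).toNat = K + 1 := by omega
  rw [this] at hlt
  exact lt_irrefl _ hlt

/-- Shifting: after removal of few points, the rest splits into groups of height at most `2 * K`
that are more than `2` apart. -/
theorem exists_grouping {ι : Type*} (T : Finset ι) (y : ι → ℝ) (K : ℕ) :
    ∃ T' ⊆ T, ∃ g : ι → ℤ, K * T.card ≤ (K + 1) * T'.card ∧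
      (∀ i ∈ T', ∀ j ∈ T', g i = g j → y j ≤ y i + 2 * K) ∧
      ∀ i ∈ T', ∀ j ∈ T', g i < g j → y i + 2 < y j := by
  classical
  obtain ⟨ρ, hρ⟩ := exists_sparse_residue T (fun i => ⌊y i / 2⌋) K
  have hp : (0 : ℤ) < K + 1 := by positivity
  -- Rows have height 2 and the rows of residue `ρ` are deleted. A group is the block of `K` rows
  -- between two deleted ones.
  refine ⟨T.filter fun i => ¬ (⌊y i / 2⌋ - ρ) % (K + 1) = 0, Finset.filter_subset _ _,
    fun i => (⌊y i / 2⌋ - ρ) / (K + 1), ?_, ?_, ?_⟩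
  · have := Finset.card_filter_add_card_filter_not (s := T)
      (fun i => (⌊y i / 2⌋ - ρ) % ((K : ℤ) + 1) = 0)
    nlinarith
  all_goals
    intro i hi j hj hij
    have hi := (Finset.mem_filter.1 hi).2
    have hj := (Finset.mem_filter.1 hj).2
    have i1 := Int.emod_nonneg (⌊y i / 2⌋ - ρ) hp.ne'
    have i2 := Int.emod_lt_of_pos (⌊y i / 2⌋ - ρ) hp
    have i3 := Int.emod_add_mul_ediv (⌊y i / 2⌋ - ρ) (K + 1)
    have j1 := Int.emod_nonneg (⌊y j / 2⌋ - ρ) hp.ne'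
    have j2 := Int.emod_lt_of_pos (⌊y j / 2⌋ - ρ) hp
    have j3 := Int.emod_add_mul_ediv (⌊y j / 2⌋ - ρ) (K + 1)
    have fi1 := Int.floor_le (y i / 2)
    have fi2 := Int.lt_floor_add_one (y i / 2)
    have fj1 := Int.floor_le (y j / 2)
    have fj2 := Int.lt_floor_add_one (y j / 2)
  · simp only at hij
    rw [hij] at i3
    -- Surviving residues lie between `1` and `K`, so rows of one block differ by at most `K - 1`.
    have : ⌊y j / 2⌋ + 1 ≤ ⌊y i / 2⌋ + K := by omega
    have : ((⌊y j / 2⌋ : ℤ) : ℝ) + 1 ≤ ⌊y i / 2⌋ + K := by exact_mod_cast this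
    linarith
  · simp only at hij
    -- Between different blocks at least one full row is missing; the half-open rows make the gap
    -- strictly larger than 2.
    have : ⌊y i / 2⌋ + 2 ≤ ⌊y j / 2⌋ := by
      nlinarith [Int.add_one_le_iff.2 hij, Int.add_one_le_iff.2 (lt_of_le_of_ne i1 (Ne.symm hi)),
        Int.add_one_le_iff.2 (lt_of_le_of_ne j1 (Ne.symm hj))]
    have : ((⌊y i / 2⌋ : ℤ) : ℝ) + 2 ≤ ⌊y j / 2⌋ := by exact_mod_cast this
    linarith

/-- Every feasible solution gives rise to a window-valid list of records that is not much
shorter. -/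
theorem exists_windowValid {n : ℕ} {c : Fin n → EuclideanSpace ℝ (Fin 2)} {D : Table} {K V : ℕ}
    (hk : D.k = K) (hx : ∀ i : Fin n, D.x i = c i 0) (hy : ∀ i : Fin n, D.y i = c i 1)
    (hrec : ∀ i < n, ∀ a < n, ∀ b < n, ∀ q < 2,
      ∃ r, 1 ≤ r ∧ r ≤ V ∧ D.I r = i ∧ D.A r = a ∧ D.B r = b ∧ D.C r = q)
    {T : Finset (Fin n)} (hT : IsFeasible c T) (w : ℕ) :
    ∃ l : List ℕ, WindowValid D.Fit D.Prec w l ∧ (∀ r ∈ l, 1 ≤ r ∧ r ≤ V) ∧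
      K * T.card ≤ (K + 1) * l.length := by
  classical
  obtain ⟨col, hcol⟩ := (isFeasible_iff c T).1 hT
  obtain ⟨T', hTT', g, hcard, hsame, hdiff⟩ := exists_grouping T (fun i => c i 1) K
  have hlo : ∀ i ∈ T', ∃ a ∈ T', g a = g i ∧ ∀ j ∈ T', g j = g i → c a 1 ≤ c j 1 := by
    intro i hi
    obtain ⟨a, ha, hmin⟩ := Finset.exists_min_image (T'.filter fun j => g j = g i)
      (fun j => c j 1) ⟨i, by simp [hi]⟩
    rw [Finset.mem_filter] at ha
    exact ⟨a, ha.1, ha.2, fun j hj hji => hmin j (by simp [hj, hji])⟩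
  have hhi : ∀ i ∈ T', ∃ a ∈ T', g a = g i ∧ ∀ j ∈ T', g j = g i → c j 1 ≤ c a 1 := by
    intro i hi
    obtain ⟨a, ha, hmax⟩ := Finset.exists_max_image (T'.filter fun j => g j = g i)
      (fun j => c j 1) ⟨i, by simp [hi]⟩
    rw [Finset.mem_filter] at ha
    exact ⟨a, ha.1, ha.2, fun j hj hji => hmax j (by simp [hj, hji])⟩
  -- The extreme points are chosen once per group: `Right` compares the indices `A` and `B`, so ties
  -- in height must be broken in the same way for all members.
  have hends : ∃ lo hi : ℤ → Fin n → Fin n, ∀ i ∈ T',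
      (lo (g i) i ∈ T' ∧ g (lo (g i) i) = g i ∧ ∀ j ∈ T', g j = g i → c (lo (g i) i) 1 ≤ c j 1) ∧
      (hi (g i) i ∈ T' ∧ g (hi (g i) i) = g i ∧ ∀ j ∈ T', g j = g i → c j 1 ≤ c (hi (g i) i) 1) ∧
      ∀ j ∈ T', g j = g i → lo (g j) j = lo (g i) i ∧ hi (g j) j = hi (g i) i := by
    have h1 : ∀ z : ℤ, ∃ a b : Fin n → Fin n, ∀ i ∈ T', g i = z →
        (a i ∈ T' ∧ g (a i) = z ∧ ∀ j ∈ T', g j = z → c (a i) 1 ≤ c j 1) ∧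
        (b i ∈ T' ∧ g (b i) = z ∧ ∀ j ∈ T', g j = z → c j 1 ≤ c (b i) 1) ∧
        ∀ j, a j = a i ∧ b j = b i := by
      intro z
      by_cases hz : ∃ i ∈ T', g i = z
      · obtain ⟨i, hi, rfl⟩ := hz
        obtain ⟨a, ha⟩ := hlo i hi
        obtain ⟨b, hb⟩ := hhi i hi
        exact ⟨fun _ => a, fun _ => b, fun j hj hji => ⟨ha, hb, fun _ => ⟨rfl, rfl⟩⟩⟩
      · exact ⟨id, id, fun i hi h => absurd ⟨i, hi, h⟩ hz⟩
    choose lo hi hlohi using h1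
    refine ⟨lo, hi, fun i hi' => ?_⟩
    obtain ⟨h1, h2, h3⟩ := hlohi (g i) i hi' rfl
    refine ⟨h1, h2, fun j hj hji => ?_⟩
    rw [hji]
    exact h3 j
  obtain ⟨lo, hi, hends⟩ := hends
  choose φ hφ1 hφV hφI hφA hφB hφC using fun i : Fin n =>
    hrec i i.2 (lo (g i) i) (Fin.is_lt _) (hi (g i) i) (Fin.is_lt _) (col i) (Fin.is_lt _)
  -- Reverse sweep order, because lists carry their newest element first.
  let le : Fin n → Fin n → Prop := fun i j => g j < g i ∨ (g i = g j ∧ c j 0 ≤ c i 0)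
  have htot : Std.Total le := ⟨fun i j => by
    rcases lt_trichotomy (g i) (g j) with h | h | h
    · exact Or.inr (Or.inl h)
    · rcases le_total (c i 0) (c j 0) with h' | h'
      · exact Or.inr (Or.inr ⟨h.symm, h'⟩)
      · exact Or.inl (Or.inr ⟨h, h'⟩)
    · exact Or.inl (Or.inl h)⟩
  have htrans : IsTrans (Fin n) le := ⟨fun i j k hij hjk => by
    rcases hij with h | ⟨h, h'⟩ <;> rcases hjk with h2 | ⟨h2, h2'⟩
    · exact Or.inl (h2.trans h)
    · exact Or.inl (h2 ▸ h)
    · exact Or.inl (h ▸ h2)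
    · exact Or.inr ⟨h.trans h2, h2'.trans h'⟩⟩
  have hperm := List.perm_insertionSort le T'.toList
  have hsorted := List.pairwise_insertionSort le T'.toList
  have hnodup : (T'.toList.insertionSort le).Nodup := hperm.nodup_iff.2 T'.nodup_toList
  have hmem : ∀ i ∈ T'.toList.insertionSort le, i ∈ T' := fun i hi => by
    simpa using hperm.mem_iff.1 hi
  refine ⟨(T'.toList.insertionSort le).map φ, windowValid_of_pairwise ?_ ?_, ?_, ?_⟩
  · intro r hr
    obtain ⟨i, hi', rfl⟩ := List.mem_map.1 hr
    have hi' := hmem i hi'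
    obtain ⟨⟨l1, l2, l3⟩, ⟨u1, u2, u3⟩, -⟩ := hends i hi'
    refine ⟨?_, ?_, ?_⟩
    · rw [hφA, hφI, hy, hy]; exact l3 i hi' rfl
    · rw [hφB, hφI, hy, hy]; exact u3 i hi' rfl
    · rw [hφA, hφB, hy, hy, hk]; exact hsame _ l1 _ u1 (l2.trans u2.symm)
  · rw [List.pairwise_map]
    refine List.Pairwise.imp_of_mem ?_ (List.Pairwise.and hsorted hnodup)
    rintro r s hr hs ⟨hrs, hne⟩
    have hr := hmem r hr
    have hs := hmem s hs
    obtain ⟨⟨l1, l2, l3⟩, ⟨u1, u2, u3⟩, h4⟩ := hends r hr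
    obtain ⟨-, ⟨u1', u2', u3'⟩, -⟩ := hends s hs
    rcases hrs with h | ⟨h, h'⟩
    · left
      unfold Table.Above
      rw [hφA, hφB, hy, hy]
      exact hdiff _ u1' _ l1 (by rw [u2', l2]; exact h)
    · right
      obtain ⟨e1, e2⟩ := h4 s hs h.symm
      refine ⟨⟨?_, ?_, ?_⟩, ?_, ?_⟩
      · rw [hφA, hφA, e1]
      · rw [hφB, hφB, e2]
      · rw [hφI, hφI, hx, hx]; exact h'
      · rw [hφI, hφI]; exact fun h => hne (Fin.ext h.symm)
      · rintro ⟨hc, hd⟩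
        rw [hφI, hφI, hx, hx, hy, hy] at hd
        rw [hφC, hφC] at hc
        exact hcol s (hTT' hs) r (hTT' hr) (Ne.symm hne) hd (Fin.ext hc)
  · intro r hr
    obtain ⟨i, -, rfl⟩ := List.mem_map.1 hr
    exact ⟨hφ1 i, hφV i⟩
  · rw [List.length_map, hperm.length_eq, Finset.length_toList]
    exact hcard

/-- The points of a window-valid list of records form a feasible solution. -/
theorem isFeasible_of_windowValid {n : ℕ} {c : Fin n → EuclideanSpace ℝ (Fin 2)} {D : Table}
    {K w : ℕ} (hk : D.k = K) (hx : ∀ i : Fin n, D.x i = c i 0) (hy : ∀ i : Fin n, D.y i = c i 1)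
    (hw : 2 * (3 * (2 * K + 1)) < w) {l : List ℕ} (hl : WindowValid D.Fit D.Prec w l)
    (hI : ∀ r ∈ l, D.I r < n) (hC : ∀ r ∈ l, D.C r < 2)
    {S : Finset (Fin n)} (hS : ∀ i : Fin n, i ∈ S ↔ ∃ r ∈ l, D.I r = i) :
    IsFeasible c S ∧ S.card = l.length := by
  classical
  have hpw := Table.pairwise_compatible hk hw hC hl
  have hnd : (l.map D.I).Nodup := by
    rw [List.Nodup, List.pairwise_map]
    exact hpw.imp fun h => h.1.symm
  constructor
  -- The colour of a disk is read off the unique record that names it; unlisted disks get colour 0.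
  · have hex : ∀ i : Fin n, ∃ q : Fin 2, ∀ r ∈ l, D.I r = i → D.C r = q := by
      intro i
      by_cases h : ∃ r ∈ l, D.I r = i
      · obtain ⟨r, hr, hri⟩ := h
        refine ⟨⟨D.C r, hC r hr⟩, fun s hs hsi => ?_⟩
        have := List.inj_on_of_nodup_map hnd hs hr (hsi.trans hri.symm)
        rw [this]
      · exact ⟨0, fun r hr hri => absurd ⟨r, hr, hri⟩ h⟩
    choose col hcol using hex
    refine (isFeasible_iff c S).2 ⟨col, fun i hi j hj hij hd heq => ?_⟩
    obtain ⟨r, hr, hri⟩ := (hS i).1 hi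
    obtain ⟨s, hs, hsj⟩ := (hS j).1 hj
    have hrs : r ≠ s := fun h => hij (Fin.ext (by rw [← hri, ← hsj, h]))
    have hclash : ∀ r s, D.Clash s r → D.Clash r s := fun r s h =>
      ⟨h.1.symm, by have := h.2; nlinarith⟩
    have hsymm : Std.Symm fun r s => ¬ D.Clash r s := ⟨fun _ _ h h' => h (hclash _ _ h')⟩
    have : ¬ D.Clash r s :=
      (hpw.imp (S := fun r s => ¬ D.Clash r s) fun h h' => h.2 (hclash _ _ h')).forall hr hs hrs
    apply this
    refine ⟨?_, ?_⟩
    · rw [hcol i r hr hri, hcol j s hs hsj, heq]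
    · rw [hri, hsj, hx, hx, hy, hy]; exact hd
  · have : (l.map D.I).toFinset = S.map Fin.valEmbedding := by
      ext i
      simp only [List.mem_toFinset, List.mem_map, Finset.mem_map, Fin.valEmbedding_apply]
      constructor
      · rintro ⟨r, hr, rfl⟩
        exact ⟨⟨D.I r, hI r hr⟩, (hS _).2 ⟨r, hr, rfl⟩, rfl⟩
      · rintro ⟨j, hj, rfl⟩
        exact (hS j).1 hj
    rw [← Finset.card_map Fin.valEmbedding, ← this, List.toFinset_card_of_nodup hnd,
      List.length_map]

/-! ### Lists stored as paths in a tree of parent pointers. -/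

/-- Linked entries: each has a parent, a label, and the length of the path to the root `0`. -/
structure Entries where
  par : ℕ → ℕ
  lab : ℕ → ℕ
  len : ℕ → ℕ

namespace Entries

/-- The first `k` labels on the way from an entry to the root. -/
def labels (E : Entries) : ℕ → ℕ → List ℕ
  | 0, _ => []
  | k + 1, f => E.lab f :: E.labels k (E.par f)

/-- The labels on the way from an entry to the root. -/
def path (E : Entries) (f : ℕ) : List ℕ := E.labels (E.len f) f

/-- The entries below `m` form a tree with root `0` and labels between `1` and `V`. -/
structure Tree (E : Entries) (V m : ℕ) : Prop where
  par_zero : E.par 0 = 0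
  lab_zero : E.lab 0 = 0
  len_zero : E.len 0 = 0
  par_lt : ∀ f, 0 < f → f < m → E.par f < f
  len_eq : ∀ f, 0 < f → f < m → E.len f = E.len (E.par f) + 1
  lab_pos : ∀ f, 0 < f → f < m → 1 ≤ E.lab f
  lab_le : ∀ f, 0 < f → f < m → E.lab f ≤ V

/-- Write a new entry with label `r` and parent `e` at place `m`. -/
def push (E : Entries) (m e r : ℕ) : Entries where
  par := Function.update E.par m e
  lab := Function.update E.lab m r
  len := Function.update E.len m (E.len e + 1)

theorem length_labels (E : Entries) (k f : ℕ) : (E.labels k f).length = k := by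
  induction k generalizing f with
  | zero => rfl
  | succ k ih => simp [labels, ih]

theorem length_path (E : Entries) (f : ℕ) : (E.path f).length = E.len f := E.length_labels _ _

variable {E : Entries} {V m e r f g w : ℕ}

theorem Tree.path_zero (h : E.Tree V m) : E.path 0 = [] := by simp [path, h.len_zero, labels]

theorem Tree.path_eq (h : E.Tree V m) (h0 : 0 < f) (hf : f < m) :
    E.path f = E.lab f :: E.path (E.par f) := by
  simp [path, h.len_eq f h0 hf, labels]

theorem Tree.iterate_zero (h : E.Tree V m) (j : ℕ) : E.par^[j] 0 = 0 :=
  Function.iterate_fixed h.par_zero j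

theorem Tree.iterate_lt (h : E.Tree V m) (hf : f < m) (j : ℕ) : E.par^[j] f < m := by
  induction j generalizing f with
  | zero => exact hf
  | succ j ih =>
    rw [Function.iterate_succ_apply]
    apply ih
    rcases Nat.eq_zero_or_pos f with rfl | h0
    · rwa [h.par_zero]
    · exact (h.par_lt f h0 hf).trans hf

theorem Tree.lab_le_of_lt (h : E.Tree V m) (hf : f < m) : E.lab f ≤ V := by
  rcases Nat.eq_zero_or_pos f with rfl | h0
  · rw [h.lab_zero]; exact Nat.zero_le V
  · exact h.lab_le f h0 hf

theorem Tree.forall_mem_path (h : E.Tree V m) :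
    ∀ {f}, f < m → ∀ s ∈ E.path f, 1 ≤ s ∧ s ≤ V := by
  intro f
  induction f using Nat.strong_induction_on with
  | _ f ih =>
    intro hf s hs
    rcases Nat.eq_zero_or_pos f with rfl | h0
    · simp [h.path_zero] at hs
    · rw [h.path_eq h0 hf, List.mem_cons] at hs
      rcases hs with rfl | hs
      · exact ⟨h.lab_pos f h0 hf, h.lab_le f h0 hf⟩
      · have := h.par_lt f h0 hf
        exact ih _ this (this.trans hf) s hs

/-- Translates a window of the path into what a loop following parent pointers sees. The root is its
own parent, so steps past the end of a short path stay at `0` and are ignored. -/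
theorem Tree.forall_take_iff (h : E.Tree V m) (P : ℕ → Prop) (hf : f < m) :
    (∀ s ∈ (E.path f).take w, P s) ↔ ∀ j < w, E.par^[j] f ≠ 0 → P (E.lab (E.par^[j] f)) := by
  induction w generalizing f with
  | zero => simp
  | succ w ih =>
    rcases Nat.eq_zero_or_pos f with rfl | h0
    · simp [h.path_zero, h.iterate_zero]
    · rw [h.path_eq h0 hf, List.take_succ_cons, List.forall_mem_cons,
        ih ((h.par_lt f h0 hf).trans hf), Nat.forall_lt_succ_left]
      simp [h0.ne']

/-- With equal lengths both walks reach the root together, after which the label `0` repeats on both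
sides. -/
theorem Tree.take_eq_iff (h : E.Tree V m) (hf : f < m) (hg : g < m) (hfg : E.len f = E.len g) :
    (E.path f).take w = (E.path g).take w ↔
      ∀ j < w, E.lab (E.par^[j] f) = E.lab (E.par^[j] g) := by
  induction w generalizing f g with
  | zero => simp
  | succ w ih =>
    rcases Nat.eq_zero_or_pos f with rfl | hf0 <;> rcases Nat.eq_zero_or_pos g with rfl | hg0
    · simp
    · have := h.len_eq g hg0 hg; rw [h.len_zero] at hfg; omega
    · have := h.len_eq f hf0 hf; rw [h.len_zero] at hfg; omega
    · rw [h.path_eq hf0 hf, h.path_eq hg0 hg, List.take_succ_cons, List.take_succ_cons,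
        List.cons.injEq, ih ((h.par_lt f hf0 hf).trans hf) ((h.par_lt g hg0 hg).trans hg),
        Nat.forall_lt_succ_left]
      · simp
      · have := h.len_eq f hf0 hf; have := h.len_eq g hg0 hg; omega

theorem push_par_of_lt (hf : f < m) : (E.push m e r).par f = E.par f :=
  Function.update_of_ne hf.ne _ _

theorem push_lab_of_lt (hf : f < m) : (E.push m e r).lab f = E.lab f :=
  Function.update_of_ne hf.ne _ _

theorem push_len_of_lt (hf : f < m) : (E.push m e r).len f = E.len f :=
  Function.update_of_ne hf.ne _ _

theorem push_par_self : (E.push m e r).par m = e := Function.update_self _ _ _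

theorem push_lab_self : (E.push m e r).lab m = r := Function.update_self _ _ _

theorem push_len_self : (E.push m e r).len m = E.len e + 1 := Function.update_self _ _ _

theorem Tree.push (h : E.Tree V m) (he : e < m) (hr : 1 ≤ r) (hrV : r ≤ V) :
    (E.push m e r).Tree V (m + 1) := by
  have h0 : 0 < m := by omega
  constructor
  · rw [push_par_of_lt h0, h.par_zero]
  · rw [push_lab_of_lt h0, h.lab_zero]
  · rw [push_len_of_lt h0, h.len_zero]
  all_goals
    intro f hf0 hf
    rcases Nat.lt_succ_iff_lt_or_eq.1 hf with hf | rfl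
  · rw [push_par_of_lt hf]; exact h.par_lt f hf0 hf
  · rwa [push_par_self]
  · rw [push_len_of_lt hf, push_par_of_lt hf, push_len_of_lt ((h.par_lt f hf0 hf).trans hf)]
    exact h.len_eq f hf0 hf
  · rw [push_len_self, push_par_self, push_len_of_lt he]
  · rw [push_lab_of_lt hf]; exact h.lab_pos f hf0 hf
  · rwa [push_lab_self]
  · rw [push_lab_of_lt hf]; exact h.lab_le f hf0 hf
  · rwa [push_lab_self]

theorem Tree.mono (h : E.Tree V m) {m' : ℕ} (hm : m' ≤ m) : E.Tree V m' :=
  ⟨h.par_zero, h.lab_zero, h.len_zero, fun f h0 hf => h.par_lt f h0 (hf.trans_le hm),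
    fun f h0 hf => h.len_eq f h0 (hf.trans_le hm), fun f h0 hf => h.lab_pos f h0 (hf.trans_le hm),
    fun f h0 hf => h.lab_le f h0 (hf.trans_le hm)⟩

theorem Tree.push_path_of_lt (h : E.Tree V m) (he : e < m) (hr : 1 ≤ r) (hrV : r ≤ V) :
    ∀ {f}, f < m → (E.push m e r).path f = E.path f := by
  intro f
  have h' := h.push he hr hrV
  induction f using Nat.strong_induction_on with
  | _ f ih =>
    intro hf
    rcases Nat.eq_zero_or_pos f with rfl | h0
    · rw [h.path_zero, h'.path_zero]
    · have hp := h.par_lt f h0 hf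
      rw [h.path_eq h0 hf, h'.path_eq h0 (by omega), push_lab_of_lt hf, push_par_of_lt hf,
        ih _ hp (hp.trans hf)]

theorem Tree.push_path_self (h : E.Tree V m) (he : e < m) (hr : 1 ≤ r) (hrV : r ≤ V) :
    (E.push m e r).path m = r :: E.path e := by
  rw [(h.push he hr hrV).path_eq (by omega) (Nat.lt_succ_self m), push_lab_self, push_par_self,
    h.push_path_of_lt he hr hrV he]

/-! ### Breadth-first search over lists modulo equality of length and window. -/

variable (G : ℕ → Prop) (R : ℕ → ℕ → Prop)

/-- The extension of entry `e` by the label `r` has been taken care of. -/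
def Done (E : Entries) (w V m e r : ℕ) : Prop :=
  1 ≤ r → r ≤ V → G r → (∀ s ∈ (E.path e).take w, R s r) →
    ∃ g < m, E.len g = E.len e + 1 ∧ (E.path g).take w = (r :: E.path e).take w

/-- State of the search: `m` entries of which those below `e` have been extended. -/
structure Search (E : Entries) (w V m e : ℕ) : Prop where
  tree : E.Tree V m
  pos : 0 < m
  le : e ≤ m
  valid : ∀ f < m, WindowValid G R w (E.path f)
  fresh : ∀ f g, f < g → g < m → E.len f = E.len g → (E.path f).take w ≠ (E.path g).take w
  mono : ∀ f g, f ≤ g → g < m → E.len f ≤ E.len g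
  near : e < m → ∀ f < m, E.len f ≤ E.len e + 1
  done : ∀ f < e, ∀ r, E.Done G R w V m f r

variable {G R}

theorem search_init (h0 : E.par 0 = 0) (h1 : E.lab 0 = 0) (h2 : E.len 0 = 0) :
    E.Search G R w V 1 0 := by
  have ht : E.Tree V 1 := ⟨h0, h1, h2, by omega, by omega, by omega, by omega⟩
  refine ⟨ht, one_pos, zero_le_one, ?_, by omega, ?_, ?_, by omega⟩
  · intro f hf
    obtain rfl : f = 0 := by omega
    rw [ht.path_zero]; trivial
  · intro f g hfg hg
    obtain rfl : g = 0 := by omega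
    obtain rfl : f = 0 := by omega
    exact le_rfl
  · intro _ f hf
    obtain rfl : f = 0 := by omega
    omega

/-- `near` survives the move because lengths are monotone: entry `e + 1` is at least as long as
entry `e`. -/
theorem Search.next (h : E.Search G R w V m e) (he : e < m)
    (hd : ∀ r, r ≤ V → E.Done G R w V m e r) : E.Search G R w V m (e + 1) := by
  refine ⟨h.tree, h.pos, he, h.valid, h.fresh, h.mono, fun he' f hf => ?_, fun f hf r => ?_⟩
  · have := h.near he f hf
    have := h.mono e (e + 1) (by omega) he'
    omega
  · rcases Nat.lt_succ_iff_lt_or_eq.1 hf with hf | rfl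
    · exact h.done f hf r
    · exact fun h1 h2 => hd r h2 h1 h2

/-- Writing at place `m` leaves all earlier entries and their paths alone, so old witnesses persist
whether or not `m` is advanced. -/
theorem Done.push {f q : ℕ} (h : E.Done G R w V m f q) (ht : E.Tree V m) (he : e < m)
    (hr : 1 ≤ r) (hrV : r ≤ V) (hf : f < m) {m' : ℕ} (hm : m ≤ m') :
    (E.push m e r).Done G R w V m' f q := by
  intro h1 h2 h3 h4
  rw [ht.push_path_of_lt he hr hrV hf] at h4
  obtain ⟨g, hg, h5, h6⟩ := h h1 h2 h3 h4
  refine ⟨g, by omega, ?_, ?_⟩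
  · rw [push_len_of_lt hg, push_len_of_lt hf, h5]
  · rw [ht.push_path_of_lt he hr hrV hg, ht.push_path_of_lt he hr hrV hf, h6]

/-- A rejected candidate may be left in the first free place. -/
theorem Search.reject (h : E.Search G R w V m e) (he : e < m) (hr : 1 ≤ r) (hrV : r ≤ V) :
    (E.push m e r).Search G R w V m e := by
  have hp := fun {f} => h.tree.push_path_of_lt he hr hrV (f := f)
  refine ⟨(h.tree.push he hr hrV).mono (Nat.le_succ m), h.pos, h.le, ?_, ?_, ?_, ?_, ?_⟩
  · intro f hf
    rw [hp hf]; exact h.valid f hf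
  · intro f g hfg hg
    rw [hp hg, hp (hfg.trans hg), push_len_of_lt hg, push_len_of_lt (hfg.trans hg)]
    exact h.fresh f g hfg hg
  · intro f g hfg hg
    rw [push_len_of_lt hg, push_len_of_lt (hfg.trans_lt hg)]
    exact h.mono f g hfg hg
  · intro _ f hf
    rw [push_len_of_lt hf, push_len_of_lt he]
    exact h.near he f hf
  · intro f hf q
    exact (h.done f hf q).push h.tree he hr hrV (hf.trans he) le_rfl

/-- Appending at the end keeps lengths sorted, since by `near` no entry is longer than `len e + 1`.
-/
theorem Search.accept (h : E.Search G R w V m e) (he : e < m) (hr : 1 ≤ r) (hrV : r ≤ V)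
    (hG : G r) (hR : ∀ s ∈ (E.path e).take w, R s r)
    (hnew : ∀ g < m, E.len g = E.len e + 1 → (E.path g).take w ≠ (r :: E.path e).take w) :
    (E.push m e r).Search G R w V (m + 1) e := by
  have hp := fun {f} => h.tree.push_path_of_lt he hr hrV (f := f)
  have hpm := h.tree.push_path_self he hr hrV
  refine ⟨h.tree.push he hr hrV, by omega, by omega, ?_, ?_, ?_, ?_, ?_⟩
  · intro f hf
    rcases Nat.lt_succ_iff_lt_or_eq.1 hf with hf | rfl
    · rw [hp hf]; exact h.valid f hf
    · rw [hpm]; exact ⟨hG, hR, h.valid e he⟩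
  · intro f g hfg hg
    rcases Nat.lt_succ_iff_lt_or_eq.1 hg with hg | rfl
    · rw [hp hg, hp (hfg.trans hg), push_len_of_lt hg, push_len_of_lt (hfg.trans hg)]
      exact h.fresh f g hfg hg
    · rw [hp hfg, hpm, push_len_of_lt hfg, push_len_self]
      exact hnew f hfg
  · intro f g hfg hg
    rcases Nat.lt_succ_iff_lt_or_eq.1 hg with hg | rfl
    · rw [push_len_of_lt hg, push_len_of_lt (hfg.trans_lt hg)]
      exact h.mono f g hfg hg
    · rcases hfg.lt_or_eq with hfg | rfl
      · rw [push_len_of_lt hfg, push_len_self]; exact h.near he f hfg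
      · exact le_rfl
  · intro _ f hf
    rw [push_len_of_lt he]
    rcases Nat.lt_succ_iff_lt_or_eq.1 hf with hf | rfl
    · rw [push_len_of_lt hf]; exact h.near he f hf
    · rw [push_len_self]
  · intro f hf q
    exact (h.done f hf q).push h.tree he hr hrV (hf.trans he) (Nat.le_succ m)

theorem Search.done_accept (h : E.Search G R w V m e) (he : e < m) (hr : 1 ≤ r) (hrV : r ≤ V) :
    (E.push m e r).Done G R w V (m + 1) e r := by
  intro _ _ _ _
  refine ⟨m, Nat.lt_succ_self m, ?_, ?_⟩
  · rw [push_len_self, push_len_of_lt he]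
  · rw [h.tree.push_path_self he hr hrV, h.tree.push_path_of_lt he hr hrV he]

/-- An admissible label is rejected only as a duplicate, and the entry it duplicates is the required
witness. -/
theorem Search.done_reject (h : E.Search G R w V m e) (he : e < m) (hr : 1 ≤ r) (hrV : r ≤ V)
    (hno : ¬ (G r ∧ (∀ s ∈ (E.path e).take w, R s r) ∧
      ∀ g < m, E.len g = E.len e + 1 → (E.path g).take w ≠ (r :: E.path e).take w)) :
    (E.push m e r).Done G R w V m e r := by
  refine Done.push ?_ h.tree he hr hrV he le_rfl
  intro _ _ hG hR
  by_contra hcon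
  push Not at hcon
  exact hno ⟨hG, hR, hcon⟩

/-- The number of entries is bounded, since they differ in length or in their last `w` labels. -/
theorem Search.card_le (h : E.Search G R w V m e) {n : ℕ} (hn : ∀ f < m, E.len f ≤ n) :
    m ≤ (n + 1) * (V + 1) ^ w := by
  let φ : Fin m → Fin (n + 1) × (Fin w → Fin (V + 1)) := fun f =>
    (⟨E.len f, Nat.lt_succ_of_le (hn f f.2)⟩, fun j =>
      ⟨E.lab (E.par^[j] f), Nat.lt_succ_of_le (h.tree.lab_le_of_lt (h.tree.iterate_lt f.2 j))⟩)
  have key : ∀ f g : Fin m, f < g → φ f ≠ φ g := by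
    intro f g hfg heq
    simp only [φ, Prod.mk.injEq, Fin.mk.injEq, funext_iff] at heq
    exact h.fresh f g hfg g.2 heq.1
      ((h.tree.take_eq_iff f.2 g.2 heq.1).2 fun j hj => heq.2 ⟨j, hj⟩)
  have hinj : Function.Injective φ := by
    intro f g heq
    rcases lt_trichotomy f g with hfg | hfg | hfg
    · exact absurd heq (key f g hfg)
    · exact hfg
    · exact absurd heq.symm (key g f hfg)
  simpa using Fintype.card_le_of_injective φ hinj

/-- The exchange argument of dynamic programming: the stored list may differ from `l`, but it has
the same length and window, hence admits the same extensions. -/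
theorem Search.exists_entry (h : E.Search G R w V m m) :
    ∀ {l : List ℕ}, WindowValid G R w l → (∀ r ∈ l, 1 ≤ r ∧ r ≤ V) →
      ∃ f < m, E.len f = l.length ∧ (E.path f).take w = l.take w
  | [], _, _ => ⟨0, h.pos, h.tree.len_zero, by rw [h.tree.path_zero]⟩
  | r :: l, hl, hV => by
    obtain ⟨f, hf, h1, h2⟩ := h.exists_entry hl.2.2 fun s hs => hV s (by simp [hs])
    have hr := hV r (by simp)
    obtain ⟨g, hg, h3, h4⟩ := h.done f hf r hr.1 hr.2 hl.1 (h2 ▸ hl.2.1)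
    refine ⟨g, hg, by simp [h3, h1], ?_⟩
    rw [h4]
    rcases w with _ | w
    · simp
    · rw [List.take_succ_cons, List.take_succ_cons, List.cons.injEq]
      refine ⟨rfl, ?_⟩
      have := congrArg (List.take w) h2
      simpa [List.take_take] using this

/-- When all entries have been extended, the last one has a longest path. -/
theorem Search.length_le (h : E.Search G R w V m m) {l : List ℕ} (hl : WindowValid G R w l)
    (hV : ∀ r ∈ l, 1 ≤ r ∧ r ≤ V) : l.length ≤ E.len (m - 1) := by
  obtain ⟨f, hf, h1, -⟩ := h.exists_entry hl hV
  rw [← h1]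
  exact h.mono f (m - 1) (by omega) (by have := h.pos; omega)

end Entries

/-! ### Machine states as records of named variables. -/

open RealRAM

/-- The memory used by the algorithm. -/
structure Vars where
  n : ℕ
  w : ℕ
  i : ℕ
  a : ℕ
  b : ℕ
  c : ℕ
  V : ℕ
  e : ℕ
  m : ℕ
  r : ℕ
  ok : ℕ
  j : ℕ
  f : ℕ
  g : ℕ
  h : ℕ
  dup : ℕ
  out : ℕ → ℕ
  E : Entries
  d : Table
  eps : ℝ

/-- The state of the machine that corresponds to given values of the variables. -/
def st (v : Vars) : State where
  nvar
    | 0 => v.n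
    | 1 => v.w
    | 2 => v.i
    | 3 => v.a
    | 4 => v.b
    | 5 => v.c
    | 6 => v.V
    | 7 => v.e
    | 8 => v.m
    | 9 => v.r
    | 10 => v.ok
    | 11 => v.j
    | 12 => v.f
    | 13 => v.g
    | 14 => v.h
    | 15 => v.dup
    | _ => 0
  narr
    | 0 => v.out
    | 1 => v.d.I
    | 2 => v.d.A
    | 3 => v.d.B
    | 4 => v.d.C
    | 5 => v.E.par
    | 6 => v.E.lab
    | 7 => v.E.len
    | _ => fun _ => 0
  rvar
    | 0 => v.eps
    | 1 => v.d.k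
    | _ => 0
  rarr
    | 0 => v.d.x
    | 1 => v.d.y
    | _ => fun _ => 0

theorem update_eq_of {α : Type*} {f g : ℕ → α} {x : ℕ} {k : α} (h : g x = k)
    (h' : ∀ z, z ≠ x → g z = f z) : Function.update f x k = g := by
  funext z
  rcases eq_or_ne z x with rfl | hz
  · rw [Function.update_self, h]
  · rw [Function.update_of_ne hz, h' z hz]

theorem st_setN_eq {v u : Vars} {x k : ℕ} (h : (st u).nvar x = k)
    (h' : ∀ z, z ≠ x → (st u).nvar z = (st v).nvar z) (h1 : (st u).narr = (st v).narr)
    (h2 : (st u).rvar = (st v).rvar) (h3 : (st u).rarr = (st v).rarr) :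
    (st v).setN x k = st u := by
  apply State.ext
  · exact update_eq_of h h'
  · exact h1.symm
  · exact h2.symm
  · exact h3.symm

theorem st_setN_w (v : Vars) (k : ℕ) : (st v).setN 1 k = st { v with w := k } := by
  refine st_setN_eq rfl (fun z hz => ?_) rfl rfl rfl
  unfold st; dsimp only; split <;> first | rfl | exact absurd rfl hz

theorem st_setN_i (v : Vars) (k : ℕ) : (st v).setN 2 k = st { v with i := k } := by
  refine st_setN_eq rfl (fun z hz => ?_) rfl rfl rfl
  unfold st; dsimp only; split <;> first | rfl | exact absurd rfl hz

theorem st_setN_a (v : Vars) (k : ℕ) : (st v).setN 3 k = st { v with a := k } := by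
  refine st_setN_eq rfl (fun z hz => ?_) rfl rfl rfl
  unfold st; dsimp only; split <;> first | rfl | exact absurd rfl hz

theorem st_setN_b (v : Vars) (k : ℕ) : (st v).setN 4 k = st { v with b := k } := by
  refine st_setN_eq rfl (fun z hz => ?_) rfl rfl rfl
  unfold st; dsimp only; split <;> first | rfl | exact absurd rfl hz

theorem st_setN_c (v : Vars) (k : ℕ) : (st v).setN 5 k = st { v with c := k } := by
  refine st_setN_eq rfl (fun z hz => ?_) rfl rfl rfl
  unfold st; dsimp only; split <;> first | rfl | exact absurd rfl hz

theorem st_setN_V (v : Vars) (k : ℕ) : (st v).setN 6 k = st { v with V := k } := by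
  refine st_setN_eq rfl (fun z hz => ?_) rfl rfl rfl
  unfold st; dsimp only; split <;> first | rfl | exact absurd rfl hz

theorem st_setN_e (v : Vars) (k : ℕ) : (st v).setN 7 k = st { v with e := k } := by
  refine st_setN_eq rfl (fun z hz => ?_) rfl rfl rfl
  unfold st; dsimp only; split <;> first | rfl | exact absurd rfl hz

theorem st_setN_m (v : Vars) (k : ℕ) : (st v).setN 8 k = st { v with m := k } := by
  refine st_setN_eq rfl (fun z hz => ?_) rfl rfl rfl
  unfold st; dsimp only; split <;> first | rfl | exact absurd rfl hz

theorem st_setN_r (v : Vars) (k : ℕ) : (st v).setN 9 k = st { v with r := k } := by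
  refine st_setN_eq rfl (fun z hz => ?_) rfl rfl rfl
  unfold st; dsimp only; split <;> first | rfl | exact absurd rfl hz

theorem st_setN_ok (v : Vars) (k : ℕ) : (st v).setN 10 k = st { v with ok := k } := by
  refine st_setN_eq rfl (fun z hz => ?_) rfl rfl rfl
  unfold st; dsimp only; split <;> first | rfl | exact absurd rfl hz

theorem st_setN_j (v : Vars) (k : ℕ) : (st v).setN 11 k = st { v with j := k } := by
  refine st_setN_eq rfl (fun z hz => ?_) rfl rfl rfl
  unfold st; dsimp only; split <;> first | rfl | exact absurd rfl hz

theorem st_setN_f (v : Vars) (k : ℕ) : (st v).setN 12 k = st { v with f := k } := by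
  refine st_setN_eq rfl (fun z hz => ?_) rfl rfl rfl
  unfold st; dsimp only; split <;> first | rfl | exact absurd rfl hz

theorem st_setN_g (v : Vars) (k : ℕ) : (st v).setN 13 k = st { v with g := k } := by
  refine st_setN_eq rfl (fun z hz => ?_) rfl rfl rfl
  unfold st; dsimp only; split <;> first | rfl | exact absurd rfl hz

theorem st_setN_h (v : Vars) (k : ℕ) : (st v).setN 14 k = st { v with h := k } := by
  refine st_setN_eq rfl (fun z hz => ?_) rfl rfl rfl
  unfold st; dsimp only; split <;> first | rfl | exact absurd rfl hz

theorem st_setN_dup (v : Vars) (k : ℕ) : (st v).setN 15 k = st { v with dup := k } := by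
  refine st_setN_eq rfl (fun z hz => ?_) rfl rfl rfl
  unfold st; dsimp only; split <;> first | rfl | exact absurd rfl hz

theorem st_setR_k (v : Vars) (k : ℝ) : (st v).setR 1 k = st { v with d.k := k } := by
  apply State.ext
  · rfl
  · rfl
  · refine update_eq_of rfl fun z hz => ?_
    unfold st; dsimp only; split <;> first | rfl | exact absurd rfl hz
  · rfl

theorem st_setNCell_eq {v u : Vars} {A i k : ℕ}
    (h : (st u).narr A = Function.update ((st v).narr A) i k)
    (h' : ∀ z, z ≠ A → (st u).narr z = (st v).narr z) (h1 : (st u).nvar = (st v).nvar)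
    (h2 : (st u).rvar = (st v).rvar) (h3 : (st u).rarr = (st v).rarr) :
    (st v).setNCell A i k = st u := by
  apply State.ext
  · exact h1.symm
  · exact update_eq_of h h'
  · exact h2.symm
  · exact h3.symm

theorem st_setNCell_out (v : Vars) (i k : ℕ) :
    (st v).setNCell 0 i k = st { v with out := Function.update v.out i k } := by
  refine st_setNCell_eq rfl (fun z hz => ?_) rfl rfl rfl
  unfold st; dsimp only; split <;> first | rfl | exact absurd rfl hz

theorem st_setNCell_I (v : Vars) (i k : ℕ) :
    (st v).setNCell 1 i k = st { v with d.I := Function.update v.d.I i k } := by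
  refine st_setNCell_eq rfl (fun z hz => ?_) rfl rfl rfl
  unfold st; dsimp only; split <;> first | rfl | exact absurd rfl hz

theorem st_setNCell_A (v : Vars) (i k : ℕ) :
    (st v).setNCell 2 i k = st { v with d.A := Function.update v.d.A i k } := by
  refine st_setNCell_eq rfl (fun z hz => ?_) rfl rfl rfl
  unfold st; dsimp only; split <;> first | rfl | exact absurd rfl hz

theorem st_setNCell_B (v : Vars) (i k : ℕ) :
    (st v).setNCell 3 i k = st { v with d.B := Function.update v.d.B i k } := by
  refine st_setNCell_eq rfl (fun z hz => ?_) rfl rfl rfl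
  unfold st; dsimp only; split <;> first | rfl | exact absurd rfl hz

theorem st_setNCell_C (v : Vars) (i k : ℕ) :
    (st v).setNCell 4 i k = st { v with d.C := Function.update v.d.C i k } := by
  refine st_setNCell_eq rfl (fun z hz => ?_) rfl rfl rfl
  unfold st; dsimp only; split <;> first | rfl | exact absurd rfl hz

theorem st_setNCell_par (v : Vars) (i k : ℕ) :
    (st v).setNCell 5 i k = st { v with E.par := Function.update v.E.par i k } := by
  refine st_setNCell_eq rfl (fun z hz => ?_) rfl rfl rfl
  unfold st; dsimp only; split <;> first | rfl | exact absurd rfl hz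

theorem st_setNCell_lab (v : Vars) (i k : ℕ) :
    (st v).setNCell 6 i k = st { v with E.lab := Function.update v.E.lab i k } := by
  refine st_setNCell_eq rfl (fun z hz => ?_) rfl rfl rfl
  unfold st; dsimp only; split <;> first | rfl | exact absurd rfl hz

theorem st_setNCell_len (v : Vars) (i k : ℕ) :
    (st v).setNCell 7 i k = st { v with E.len := Function.update v.E.len i k } := by
  refine st_setNCell_eq rfl (fun z hz => ?_) rfl rfl rfl
  unfold st; dsimp only; split <;> first | rfl | exact absurd rfl hz

/-! ### Program logic for total correctness with time bounds. -/

/-- Started with the values `v`, the program halts after at most `T` steps with values that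
satisfy `Q`. -/
def Runs (p : Prog) (v : Vars) (Q : Vars → Prop) (T : ℕ) : Prop :=
  ∃ (u : Vars) (t : ℕ), Exec p (st v) (st u) t ∧ t ≤ T ∧ Q u

namespace Runs

variable {p q : Prog} {v u : Vars} {P Q : Vars → Prop} {T T' : ℕ} {b : Test}

theorem mono (h : Runs p v P T) (hT : T ≤ T') (hQ : ∀ u, P u → Q u) : Runs p v Q T' := by
  obtain ⟨u, t, h1, h2, h3⟩ := h
  exact ⟨u, t, h1, h2.trans hT, hQ u h3⟩

theorem mono_time (h : Runs p v Q T) (hT : T ≤ T') : Runs p v Q T' := h.mono hT fun _ => id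

theorem skip (hQ : Q v) : Runs .skip v Q 1 := ⟨v, 1, Exec.skip _, le_rfl, hQ⟩

theorem setN {x : ℕ} {e : NExpr} (hu : (st v).setN x (e.eval (st v)) = st u) (hQ : Q u) :
    Runs (.setN x e) v Q (e.cost + 1) :=
  ⟨u, _, hu ▸ Exec.setN _ _ _, le_rfl, hQ⟩

theorem setNCell {A : ℕ} {i e : NExpr}
    (hu : (st v).setNCell A (i.eval (st v)) (e.eval (st v)) = st u) (hQ : Q u) :
    Runs (.setNCell A i e) v Q (i.cost + e.cost + 1) :=
  ⟨u, _, hu ▸ Exec.setNCell _ _ _ _, le_rfl, hQ⟩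

theorem setR {x : ℕ} {e : RExpr} (hu : (st v).setR x (e.eval (st v)) = st u) (hQ : Q u) :
    Runs (.setR x e) v Q (e.cost + 1) :=
  ⟨u, _, hu ▸ Exec.setR _ _ _, le_rfl, hQ⟩

theorem seq (hp : Runs p v P T) (hq : ∀ u, P u → Runs q u Q T') :
    Runs (.seq p q) v Q (T + T') := by
  obtain ⟨u, t, h1, h2, h3⟩ := hp
  obtain ⟨u', t', h1', h2', h3'⟩ := hq u h3
  exact ⟨u', t + t', Exec.seq h1 h1', Nat.add_le_add h2 h2', h3'⟩

theorem setN_seq {x : ℕ} {e : NExpr} (hu : (st v).setN x (e.eval (st v)) = st u)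
    (hq : Runs q u Q T) : Runs (.seq (.setN x e) q) v Q (e.cost + 1 + T) :=
  seq (P := fun u' => u' = u) (setN hu rfl) fun _ h => h ▸ hq

theorem setNCell_seq {A : ℕ} {i e : NExpr}
    (hu : (st v).setNCell A (i.eval (st v)) (e.eval (st v)) = st u) (hq : Runs q u Q T) :
    Runs (.seq (.setNCell A i e) q) v Q (i.cost + e.cost + 1 + T) :=
  seq (P := fun u' => u' = u) (setNCell hu rfl) fun _ h => h ▸ hq

theorem setR_seq {x : ℕ} {e : RExpr} (hu : (st v).setR x (e.eval (st v)) = st u)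
    (hq : Runs q u Q T) : Runs (.seq (.setR x e) q) v Q (e.cost + 1 + T) :=
  seq (P := fun u' => u' = u) (setR hu rfl) fun _ h => h ▸ hq

theorem cond (hp : b.holds (st v) → Runs p v Q T) (hq : ¬ b.holds (st v) → Runs q v Q T) :
    Runs (.cond b p q) v Q (b.cost + T + 1) := by
  by_cases hb : b.holds (st v)
  · obtain ⟨u, t, h1, h2, h3⟩ := hp hb
    exact ⟨u, _, Exec.cond_true hb h1, by omega, h3⟩
  · obtain ⟨u, t, h1, h2, h3⟩ := hq hb
    exact ⟨u, _, Exec.cond_false hb h1, by omega, h3⟩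

/-- The variant `μ` drops in every round, so there are at most `μ v` rounds; the last summand pays
for the final failing test. -/
theorem loop (Inv : Vars → Prop) (μ : Vars → ℕ) (h0 : Inv v)
    (hbody : ∀ v, Inv v → b.holds (st v) → Runs p v (fun u => Inv u ∧ μ u < μ v) T)
    (hQ : ∀ v, Inv v → ¬ b.holds (st v) → Q v) :
    Runs (.loop b p) v Q (μ v * (b.cost + T + 1) + (b.cost + 1)) := by
  induction hk : μ v using Nat.strong_induction_on generalizing v with
  | _ k ih =>
    by_cases hb : b.holds (st v)
    · obtain ⟨u, t, h1, h2, h3, h4⟩ := hbody v h0 hb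
      obtain ⟨u', t', h1', h2', h3'⟩ := ih (μ u) (hk ▸ h4) h3 rfl
      refine ⟨u', _, Exec.loop_true hb h1 h1', ?_, h3'⟩
      have : (μ u + 1) * (b.cost + T + 1) ≤ k * (b.cost + T + 1) :=
        Nat.mul_le_mul_right _ (by omega)
      rw [Nat.add_mul, one_mul] at this
      omega
    · exact ⟨v, _, Exec.loop_false hb, Nat.le_add_left _ _, hQ v h0 hb⟩

end Runs

/-! ### The search as a program. -/

/-- The test `e < f`. -/
def ltTest (e f : NExpr) : Test := .nle (.add e (.lit 1)) f

/-- The test `e = f`. -/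
def eqTest (e f : NExpr) : Test := .and (.nle e f) (.nle f e)

/-- First coordinate of the point with a given index. -/
def xCoord (i : NExpr) : RExpr := .cell 0 i

/-- Second coordinate of the point with a given index. -/
def yCoord (i : NExpr) : RExpr := .cell 1 i

/-- The test `Table.Fit r`. -/
def fitTest (r : NExpr) : Test :=
  .and (.rle (yCoord (.cell 2 r)) (yCoord (.cell 1 r)))
    (.and (.rle (yCoord (.cell 1 r)) (yCoord (.cell 3 r)))
      (.rle (yCoord (.cell 3 r)) (.add (yCoord (.cell 2 r)) (.mul (.lit 2) (.var 1)))))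

/-- The test `Table.Clash s r`. -/
def clashTest (s r : NExpr) : Test :=
  let dx : RExpr := .sub (xCoord (.cell 1 s)) (xCoord (.cell 1 r))
  let dy : RExpr := .sub (yCoord (.cell 1 s)) (yCoord (.cell 1 r))
  .and (eqTest (.cell 4 s) (.cell 4 r)) (.rle (.add (.mul dx dx) (.mul dy dy)) (.lit 4))

/-- The test `¬ Table.Prec s r`. -/
def notPrecTest (s r : NExpr) : Test :=
  -- The strict inequality in `Above` turns, when negated, into a test by `≤`.
  .and (.rle (yCoord (.cell 2 r)) (.add (yCoord (.cell 3 s)) (.lit 2)))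
    (.not (.and (.and (eqTest (.cell 2 s) (.cell 2 r)) (.and (eqTest (.cell 3 s) (.cell 3 r))
        (.rle (xCoord (.cell 1 s)) (xCoord (.cell 1 r)))))
      (.and (.not (eqTest (.cell 1 s) (.cell 1 r))) (.not (clashTest s r)))))

theorem eqTest_holds {e f : NExpr} {σ : State} :
    (eqTest e f).holds σ ↔ e.eval σ = f.eval σ := by
  simp only [eqTest, Test.holds]; omega

theorem fitTest_holds {r : NExpr} {v : Vars} :
    (fitTest r).holds (st v) ↔ v.d.Fit (r.eval (st v)) := by
  have h : ((2 : ℤ) : ℝ) = 2 := by norm_num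
  simp only [fitTest, Test.holds, RExpr.eval, h]
  exact Iff.rfl

theorem clashTest_holds {s r : NExpr} {v : Vars} :
    (clashTest s r).holds (st v) ↔ v.d.Clash (s.eval (st v)) (r.eval (st v)) := by
  have h : ((4 : ℤ) : ℝ) = 4 := by norm_num
  simp only [clashTest, Test.holds, RExpr.eval, h, eqTest_holds]
  exact Iff.rfl

theorem notPrecTest_holds {s r : NExpr} {v : Vars} :
    (notPrecTest s r).holds (st v) ↔ ¬ v.d.Prec (s.eval (st v)) (r.eval (st v)) := by
  have h : ((2 : ℤ) : ℝ) = 2 := by norm_num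
  simp only [notPrecTest, Test.holds, RExpr.eval, h, eqTest_holds, clashTest_holds, Table.Prec,
    Table.Above, not_or, not_lt]
  exact Iff.rfl

/-- Walk up the tree from entry `f`, and clear the flag `ok` when one of the first `w` labels may
not be followed by `r`. -/
def checkWindow : Prog :=
  .loop (ltTest (.var 11) (.var 1))
    (.seq (.cond (.and (ltTest (.lit 0) (.var 12)) (notPrecTest (.cell 6 (.var 12)) (.var 9)))
      (.setN 10 (.lit 0)) .skip)
    (.seq (.setN 12 (.cell 5 (.var 12))) (.setN 11 (.add (.var 11) (.lit 1)))))

/-- Invariant: `f` is the `j`-th ancestor of the starting entry and `ok` is the verdict on the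
ancestors before it. -/
theorem runs_checkWindow (v : Vars) (hj : v.j = 0) (hok : v.ok ≤ 1) :
    Runs checkWindow v (fun u => ∃ f j ok, u = { v with f := f, j := j, ok := ok } ∧ ok ≤ 1 ∧
      (ok = 1 ↔ v.ok = 1 ∧ ∀ i < v.w, v.E.par^[i] v.f ≠ 0 →
        v.d.Prec (v.E.lab (v.E.par^[i] v.f)) v.r)) (220 * (v.w + 1)) := by
  refine Runs.mono_time (Runs.loop (T := 200) (fun u => ∃ f j ok,
    u = { v with f := f, j := j, ok := ok } ∧ ok ≤ 1 ∧ j ≤ v.w ∧ f = v.E.par^[j] v.f ∧ (ok = 1 ↔ v.ok = 1 ∧ ∀ i < j, v.E.par^[i] v.f ≠ 0 →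
        v.d.Prec (v.E.lab (v.E.par^[i] v.f)) v.r)) (fun u => v.w - u.j)
    ⟨v.f, v.j, v.ok, rfl, hok, by omega, by simp [hj], by simp [hj]⟩ ?_ ?_) ?_
  · rintro _ ⟨f, j, ok, rfl, hok, hj, hf, hiff⟩ hb
    have hb : j < v.w := hb
    refine Runs.mono_time (Runs.seq (P := fun u => ∃ ok',
      u = { v with f := f, j := j, ok := ok' } ∧ ok' ≤ 1 ∧
        (ok' = 1 ↔ ok = 1 ∧ (f ≠ 0 → v.d.Prec (v.E.lab f) v.r)))
      (Runs.cond (T := 2) (fun h => ?_) (fun h => ?_)) (T' := 10) ?_) ?_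
    · have h2 := notPrecTest_holds.1 h.2
      have h1 : 0 < f := h.1
      refine (Runs.setN (st_setN_ok _ _) ?_)
      refine ⟨0, rfl, by omega, ?_⟩
      simp only [zero_ne_one, false_iff]
      intro h'
      exact h2 (h'.2 h1.ne')
    · refine (Runs.skip ?_).mono_time (by omega)
      refine ⟨ok, rfl, hok, ?_⟩
      refine ⟨fun h' => ⟨h', fun hf0 => ?_⟩, fun h' => h'.1⟩
      by_contra hcon
      exact h ⟨Nat.pos_of_ne_zero hf0, notPrecTest_holds.2 hcon⟩
    · rintro _ ⟨ok', rfl, hok', hiff'⟩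
      refine Runs.mono_time (Runs.setN_seq (st_setN_f _ _) (Runs.setN (st_setN_j _ _)
        ⟨⟨v.E.par f, j + 1, ok', rfl, hok', hb, ?_, ?_⟩, ?_⟩)) ?_
      · rw [Function.iterate_succ_apply', ← hf]
      · rw [hiff', hiff, Nat.forall_lt_succ_right, ← hf, and_assoc]
      · show v.w - (j + 1) < v.w - j
        omega
      · simp [NExpr.cost]
    · simp [ltTest, notPrecTest, eqTest, clashTest, xCoord, yCoord, Test.cost, NExpr.cost,
        RExpr.cost]
  · rintro _ ⟨f, j, ok, rfl, hok, hj, hf, hiff⟩ hb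
    have hb : ¬ j < v.w := hb
    obtain rfl : j = v.w := by omega
    exact ⟨f, _, ok, rfl, hok, hiff⟩
  · simp only [ltTest, Test.cost, NExpr.cost]
    omega

/-- Clear the flag `dup` when the first `w` labels on the way up from the entries `f` and `h`
differ. -/
def compareWindow : Prog :=
  .loop (ltTest (.var 11) (.var 1))
    (.seq (.cond (eqTest (.cell 6 (.var 12)) (.cell 6 (.var 14))) .skip (.setN 15 (.lit 0)))
    (.seq (.setN 12 (.cell 5 (.var 12)))
    (.seq (.setN 14 (.cell 5 (.var 14))) (.setN 11 (.add (.var 11) (.lit 1))))))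

theorem runs_compareWindow (v : Vars) (hj : v.j = 0) (hdup : v.dup ≤ 1) :
    Runs compareWindow v (fun u => ∃ f h j dup, u = { v with f := f, h := h, j := j, dup := dup } ∧
      dup ≤ 1 ∧ (dup = 1 ↔ v.dup = 1 ∧ ∀ i < v.w,
        v.E.lab (v.E.par^[i] v.f) = v.E.lab (v.E.par^[i] v.h))) (60 * (v.w + 1)) := by
  refine Runs.mono_time (Runs.loop (T := 40) (fun u => ∃ f h j dup,
    u = { v with f := f, h := h, j := j, dup := dup } ∧ dup ≤ 1 ∧ j ≤ v.w ∧
      f = v.E.par^[j] v.f ∧ h = v.E.par^[j] v.h ∧ (dup = 1 ↔ v.dup = 1 ∧ ∀ i < j,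
        v.E.lab (v.E.par^[i] v.f) = v.E.lab (v.E.par^[i] v.h))) (fun u => v.w - u.j)
    ⟨v.f, v.h, v.j, v.dup, rfl, hdup, by omega, by simp [hj], by simp [hj], by simp [hj]⟩ ?_ ?_) ?_
  · rintro _ ⟨f, h, j, dup, rfl, hdup, hj, hf, hh, hiff⟩ hb
    have hb : j < v.w := hb
    refine Runs.mono_time (Runs.seq (P := fun u => ∃ dup',
      u = { v with f := f, h := h, j := j, dup := dup' } ∧ dup' ≤ 1 ∧
        (dup' = 1 ↔ dup = 1 ∧ v.E.lab f = v.E.lab h))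
      (Runs.cond (T := 2) (fun hc => ?_) (fun hc => ?_)) (T' := 13) ?_) ?_
    · have hc : v.E.lab f = v.E.lab h := eqTest_holds.1 hc
      exact (Runs.skip ⟨dup, rfl, hdup, by simp [hc]⟩).mono_time (by omega)
    · have hc : ¬ v.E.lab f = v.E.lab h := fun h' => hc (eqTest_holds.2 h')
      exact Runs.setN (st_setN_dup _ _) ⟨0, rfl, by omega, by simp [hc]⟩
    · rintro _ ⟨dup', rfl, hdup', hiff'⟩
      refine Runs.mono_time (Runs.setN_seq (st_setN_f _ _) (Runs.setN_seq (st_setN_h _ _)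
        (Runs.setN (st_setN_j _ _)
        ⟨⟨v.E.par f, v.E.par h, j + 1, dup', rfl, hdup', hb, ?_, ?_, ?_⟩, ?_⟩))) ?_
      · rw [Function.iterate_succ_apply', ← hf]
      · rw [Function.iterate_succ_apply', ← hh]
      · rw [hiff', hiff, Nat.forall_lt_succ_right, ← hf, ← hh, and_assoc]
      · show v.w - (j + 1) < v.w - j
        omega
      · simp [NExpr.cost]
    · simp [eqTest, Test.cost, NExpr.cost]
  · rintro _ ⟨f, h, j, dup, rfl, hdup, hj, hf, hh, hiff⟩ hb
    have hb : ¬ j < v.w := hb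
    obtain rfl : j = v.w := by omega
    exact ⟨f, h, _, dup, rfl, hdup, hiff⟩
  · simp only [ltTest, Test.cost, NExpr.cost]
    omega

/-- Clear the flag `ok` when an entry below `m` has the same length as entry `m` and the same first
`w` labels. -/
def checkFresh : Prog :=
  .loop (ltTest (.var 13) (.var 8))
    (.seq (.setN 12 (.var 13))
    (.seq (.setN 14 (.var 8))
    (.seq (.setN 11 (.lit 0))
    (.seq (.cond (eqTest (.cell 7 (.var 13)) (.cell 7 (.var 8)))
      (.setN 15 (.lit 1)) (.setN 15 (.lit 0)))
    (.seq compareWindow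
    (.seq (.cond (ltTest (.lit 0) (.var 15)) (.setN 10 (.lit 0)) .skip)
      (.setN 13 (.add (.var 13) (.lit 1)))))))))

/-- `dup` starts with the outcome of the length comparison, so after `compareWindow` it is 1 exactly
when length and window both agree. -/
theorem runs_checkFresh (v : Vars) (hg : v.g = 0) (hok : v.ok ≤ 1) :
    Runs checkFresh v (fun u => ∃ f h j dup g ok,
      u = { v with f := f, h := h, j := j, dup := dup, g := g, ok := ok } ∧ ok ≤ 1 ∧
      (ok = 1 ↔ v.ok = 1 ∧ ∀ g < v.m, ¬ (v.E.len g = v.E.len v.m ∧ ∀ i < v.w,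
        v.E.lab (v.E.par^[i] g) = v.E.lab (v.E.par^[i] v.m))))
      ((v.m + 1) * (120 * (v.w + 1))) := by
  refine Runs.mono_time (Runs.loop (T := 60 * (v.w + 1) + 40) (fun u => ∃ f h j dup g ok,
      u = { v with f := f, h := h, j := j, dup := dup, g := g, ok := ok } ∧ ok ≤ 1 ∧ g ≤ v.m ∧
      (ok = 1 ↔ v.ok = 1 ∧ ∀ g' < g, ¬ (v.E.len g' = v.E.len v.m ∧ ∀ i < v.w,
        v.E.lab (v.E.par^[i] g') = v.E.lab (v.E.par^[i] v.m)))) (fun u => v.m - u.g)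
    ⟨v.f, v.h, v.j, v.dup, v.g, v.ok, rfl, hok, by omega, by simp [hg]⟩ ?_ ?_) ?_
  · rintro _ ⟨f, h, j, dup, g, ok, rfl, hok, hg, hiff⟩ hb
    have hb : g < v.m := hb
    refine Runs.mono_time (Runs.setN_seq (st_setN_f _ g) (Runs.setN_seq (st_setN_h _ v.m)
      (Runs.setN_seq (st_setN_j _ 0) (Runs.seq (P := fun u => ∃ dup',
        u = { v with f := g, h := v.m, j := 0, dup := dup', g := g, ok := ok } ∧ dup' ≤ 1 ∧
        (dup' = 1 ↔ v.E.len g = v.E.len v.m))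
      (Runs.cond (T := 2) (fun hc => ?_) (fun hc => ?_)) (T' := 60 * (v.w + 1) + 13) ?_)))) ?_
    · have hc : v.E.len g = v.E.len v.m := eqTest_holds.1 hc
      exact Runs.setN (st_setN_dup _ _) ⟨1, rfl, le_rfl, by simp [hc]⟩
    · have hc : ¬ v.E.len g = v.E.len v.m := fun h' => hc (eqTest_holds.2 h')
      exact Runs.setN (st_setN_dup _ _) ⟨0, rfl, by omega, by simp [hc]⟩
    · rintro _ ⟨dup', rfl, hdup', hiff'⟩
      refine Runs.seq (runs_compareWindow _ rfl hdup') (T' := 13) ?_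
      rintro _ ⟨f₂, h₂, j₂, dup₂, rfl, hdup₂, hiff₂⟩
      refine Runs.mono_time (Runs.seq (P := fun u => ∃ ok',
        u = { v with f := f₂, h := h₂, j := j₂, dup := dup₂, g := g, ok := ok' } ∧ ok' ≤ 1 ∧
        (ok' = 1 ↔ ok = 1 ∧ ¬ dup₂ = 1))
      (Runs.cond (T := 2) (fun hc => ?_) (fun hc => ?_)) (T' := 4) ?_) ?_
      · have hc : 0 < dup₂ := hc
        exact Runs.setN (st_setN_ok _ _) ⟨0, rfl, by omega, by simp; omega⟩
      · have hc : ¬ 0 < dup₂ := hc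
        exact (Runs.skip ⟨ok, rfl, hok, by omega⟩).mono_time (by omega)
      · rintro _ ⟨ok', rfl, hok', hiff'₂⟩
        refine Runs.setN (st_setN_g _ _)
          ⟨⟨f₂, h₂, j₂, dup₂, g + 1, ok', rfl, hok', hb, ?_⟩, ?_⟩
        · rw [hiff'₂, hiff, Nat.forall_lt_succ_right, hiff₂, ← and_assoc]
          simp only [hiff']
        · show v.m - (g + 1) < v.m - g
          omega
      · simp [ltTest, Test.cost, NExpr.cost]
    · simp only [eqTest, Test.cost, NExpr.cost]
      omega
  · rintro _ ⟨f, h, j, dup, g, ok, rfl, hok, hg, hiff⟩ hb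
    have hb : ¬ g < v.m := hb
    obtain rfl : g = v.m := by omega
    exact ⟨f, h, j, dup, _, ok, rfl, hok, hiff⟩
  · simp only [ltTest, Test.cost, NExpr.cost, hg, Nat.sub_zero]
    nlinarith

/-- Try to extend entry `e` by the label `r`. -/
def tryExtend : Prog :=
  .seq (.setNCell 5 (.var 8) (.var 7))
  (.seq (.setNCell 6 (.var 8) (.var 9))
  (.seq (.setNCell 7 (.var 8) (.add (.cell 7 (.var 7)) (.lit 1)))
  (.seq (.cond (fitTest (.var 9)) (.setN 10 (.lit 1)) (.setN 10 (.lit 0)))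
  (.seq (.setN 12 (.var 7))
  (.seq (.setN 11 (.lit 0))
  (.seq checkWindow
  (.seq (.setN 13 (.lit 0))
  (.seq checkFresh
  (.seq (.setN 8 (.add (.var 8) (.var 10))) (.setN 9 (.add (.var 9) (.lit 1))))))))))))

/-- The candidate is written into the free place `m` before it is examined, so the checks can treat
it as an entry; adding the flag `ok` to `m` then keeps or discards it. -/
theorem runs_tryExtend (v : Vars) (ht : v.E.Tree v.V v.m) (he : v.e < v.m) (hr : 1 ≤ v.r)
    (hrV : v.r ≤ v.V) :
    Runs tryExtend v (fun u => ∃ f h j dup g ok,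
      u = { v with f := f, h := h, j := j, dup := dup, g := g, ok := ok, m := v.m + ok,
                   r := v.r + 1, E := v.E.push v.m v.e v.r } ∧ ok ≤ 1 ∧
      (ok = 1 ↔ v.d.Fit v.r ∧ (∀ s ∈ (v.E.path v.e).take v.w, v.d.Prec s v.r) ∧
        ∀ g < v.m, v.E.len g = v.E.len v.e + 1 →
          (v.E.path g).take v.w ≠ (v.r :: v.E.path v.e).take v.w))
      ((v.m + 3) * (220 * (v.w + 1))) := by
  have ht' := ht.push he hr hrV
  refine Runs.mono_time (Runs.setNCell_seq (st_setNCell_par _ v.m v.e)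
    (Runs.setNCell_seq (st_setNCell_lab _ v.m v.r)
    (Runs.setNCell_seq (st_setNCell_len _ v.m (v.E.len v.e + 1))
    (Runs.seq (P := fun u => ∃ ok, u = { v with E := v.E.push v.m v.e v.r, ok := ok } ∧ ok ≤ 1 ∧
      (ok = 1 ↔ v.d.Fit v.r)) (Runs.cond (T := 2) (fun hc => ?_) (fun hc => ?_))
      (T' := 220 * (v.w + 1) + (v.m + 1) * (120 * (v.w + 1)) + 20) ?_)))) ?_
  · have hc : v.d.Fit v.r := fitTest_holds.1 hc
    exact Runs.setN (st_setN_ok _ 1) ⟨1, rfl, le_rfl, by simpa using hc⟩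
  · have hc : ¬ v.d.Fit v.r := fun h' => hc (fitTest_holds.2 h')
    exact Runs.setN (st_setN_ok _ 0) ⟨0, rfl, by omega, by simpa using hc⟩
  · rintro _ ⟨ok, rfl, hok, hiff⟩
    refine Runs.mono_time (Runs.setN_seq (st_setN_f _ v.e) (Runs.setN_seq (st_setN_j _ 0)
      (Runs.seq (runs_checkWindow _ rfl hok)
        (T' := (v.m + 1) * (120 * (v.w + 1)) + 12) ?_))) ?_
    · rintro _ ⟨f₁, j₁, ok₁, rfl, hok₁, hiff₁⟩
      dsimp only at hiff₁
      refine Runs.mono_time (Runs.setN_seq (st_setN_g _ 0)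
        (Runs.seq (runs_checkFresh _ rfl hok₁) (T' := 8) ?_)) ?_
      · rintro _ ⟨f₂, h₂, j₂, dup₂, g₂, ok₂, rfl, hok₂, hiff₂⟩
        dsimp only at hiff₂
        refine Runs.mono_time (Runs.setN_seq (st_setN_m _ (v.m + ok₂))
          (Runs.setN (st_setN_r _ (v.r + 1))
            ⟨f₂, h₂, j₂, dup₂, g₂, ok₂, rfl, hok₂, ?_⟩)) (by simp [NExpr.cost])
        rw [hiff₂, hiff₁, hiff, and_assoc]
        refine and_congr Iff.rfl (and_congr ?_ (forall_congr' fun g => forall_congr' fun hg => ?_))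
        · rw [← ht'.forall_take_iff (fun s => v.d.Prec s v.r) (Nat.lt_succ_of_lt he),
            ht.push_path_of_lt he hr hrV he]
        · rw [not_and, Entries.push_len_of_lt hg, Entries.push_len_self]
          refine forall_congr' fun hlen => ?_
          rw [← ht'.take_eq_iff (Nat.lt_succ_of_lt hg) (Nat.lt_succ_self _)
            (by rw [Entries.push_len_of_lt hg, Entries.push_len_self, hlen]),
            ht.push_path_of_lt he hr hrV hg, ht.push_path_self he hr hrV]
      · simp only [NExpr.cost]
        omega
    · simp only [NExpr.cost]
      omega
  · simp only [fitTest, yCoord, Test.cost, NExpr.cost, RExpr.cost]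
    nlinarith

/-- Extend entry `e` by all possible labels, and go on to the next entry. -/
def extendAll : Prog :=
  .seq (.setN 9 (.lit 1))
  (.seq (.loop (.nle (.var 9) (.var 6)) tryExtend) (.setN 7 (.add (.var 7) (.lit 1))))

/-- `m` grows during the loop, so the time per label is bounded through `M`, a cap on the number of
entries in every reachable search state. -/
theorem runs_extendAll (v : Vars) {M : ℕ}
    (hM : ∀ E m e, Entries.Search v.d.Fit v.d.Prec E v.w v.V m e → m ≤ M)
    (hs : v.E.Search v.d.Fit v.d.Prec v.w v.V v.m v.e) (he : v.e < v.m) :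
    Runs extendAll v (fun u => ∃ f h j dup g ok m r E,
      u = { v with f := f, h := h, j := j, dup := dup, g := g, ok := ok, m := m, r := r, E := E,
                   e := v.e + 1 } ∧ E.Search v.d.Fit v.d.Prec v.w v.V m (v.e + 1))
      ((v.V + 1) * ((M + 4) * (220 * (v.w + 1)))) := by
  refine Runs.mono_time (Runs.setN_seq (st_setN_r _ 1) (Runs.seq (P := fun u =>
    ∃ f h j dup g ok m r E,
      u = { v with f := f, h := h, j := j, dup := dup, g := g, ok := ok, m := m, r := r, E := E } ∧
      E.Search v.d.Fit v.d.Prec v.w v.V m (v.e + 1))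
    (Runs.loop (T := (M + 3) * (220 * (v.w + 1))) (fun u => ∃ f h j dup g ok m r E,
      u = { v with f := f, h := h, j := j, dup := dup, g := g, ok := ok, m := m, r := r, E := E } ∧
      E.Search v.d.Fit v.d.Prec v.w v.V m v.e ∧ v.e < m ∧ 1 ≤ r ∧ r ≤ v.V + 1 ∧
      ∀ q < r, E.Done v.d.Fit v.d.Prec v.w v.V m v.e q) (fun u => v.V + 1 - u.r)
      ⟨v.f, v.h, v.j, v.dup, v.g, v.ok, v.m, 1, v.E, rfl, hs, he, le_rfl, by omega, ?_⟩ ?_ ?_)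
    (T' := 4) ?_)) ?_
  · intro q hq h1
    omega
  · rintro _ ⟨f, h, j, dup, g, ok, m, r, E, rfl, hs, he, hr, -, hd⟩ hb
    have hb : r ≤ v.V := hb
    refine (runs_tryExtend _ hs.tree he hr hb).mono
      (Nat.mul_le_mul_right _ (Nat.add_le_add_right (hM _ _ _ hs) 3)) ?_
    rintro _ ⟨f', h', j', dup', g', ok', rfl, hok, hiff⟩
    dsimp only at hiff
    refine ⟨⟨f', h', j', dup', g', ok', m + ok', r + 1, E.push m v.e r, rfl, ?_⟩, ?_⟩
    · have hd' : ∀ q < r, (E.push m v.e r).Done v.d.Fit v.d.Prec v.w v.V (m + ok') v.e q :=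
        fun q hq => (hd q hq).push hs.tree he hr hb he (by omega)
      have key : (E.push m v.e r).Search v.d.Fit v.d.Prec v.w v.V (m + ok') v.e ∧
          (E.push m v.e r).Done v.d.Fit v.d.Prec v.w v.V (m + ok') v.e r := by
        by_cases h1 : ok' = 1
        · obtain ⟨hG, hR, hN⟩ := hiff.1 h1
          rw [h1]
          exact ⟨hs.accept he hr hb hG hR hN, hs.done_accept he hr hb⟩
        · obtain rfl : ok' = 0 := by omega
          exact ⟨hs.reject he hr hb, hs.done_reject he hr hb fun h => h1 (hiff.2 h)⟩
      refine ⟨key.1, by omega, by omega, by omega, fun q hq => ?_⟩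
      rcases Nat.lt_succ_iff_lt_or_eq.1 hq with hq | rfl
      · exact hd' q hq
      · exact key.2
    · show v.V + 1 - (r + 1) < v.V + 1 - r
      omega
  · rintro _ ⟨f, h, j, dup, g, ok, m, r, E, rfl, hs, he, hr, -, hd⟩ hb
    have hb : ¬ r ≤ v.V := hb
    exact ⟨f, h, j, dup, g, ok, m, r, E, rfl, hs.next he fun q hq => hd q (by omega)⟩
  · rintro _ ⟨f, h, j, dup, g, ok, m, r, E, rfl, hs⟩
    exact Runs.setN (st_setN_e _ (v.e + 1)) ⟨f, h, j, dup, g, ok, m, r, E, rfl, hs⟩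
  · simp only [Test.cost, NExpr.cost, Nat.add_sub_cancel]
    nlinarith

/-- Build the tree of entries. -/
def search : Prog := .seq (.setN 8 (.lit 1)) (.loop (ltTest (.var 7) (.var 8)) extendAll)

/-- Each round advances `e`, and `e ≤ m ≤ M` throughout, so `M - e` is a variant although `m` itself
moves. -/
theorem runs_search (v : Vars) {M : ℕ}
    (hM : ∀ E m e, Entries.Search v.d.Fit v.d.Prec E v.w v.V m e → m ≤ M)
    (he : v.e = 0) (h0 : v.E.par 0 = 0) (h1 : v.E.lab 0 = 0) (h2 : v.E.len 0 = 0) :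
    Runs search v (fun u => ∃ f h j dup g ok m r E e,
      u = { v with f := f, h := h, j := j, dup := dup, g := g, ok := ok, m := m, r := r, E := E,
                   e := e } ∧ E.Search v.d.Fit v.d.Prec v.w v.V m m)
      ((M + 1) * ((v.V + 2) * ((M + 4) * (220 * (v.w + 1))))) := by
  refine Runs.mono_time (Runs.setN_seq (st_setN_m _ 1)
    (Runs.loop (T := (v.V + 1) * ((M + 4) * (220 * (v.w + 1)))) (fun u =>
      ∃ f h j dup g ok m r E e,
      u = { v with f := f, h := h, j := j, dup := dup, g := g, ok := ok, m := m, r := r, E := E,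
                   e := e } ∧ E.Search v.d.Fit v.d.Prec v.w v.V m e) (fun u => M - u.e)
      ⟨v.f, v.h, v.j, v.dup, v.g, v.ok, 1, v.r, v.E, v.e, rfl, ?_⟩ ?_ ?_)) ?_
  · rw [he]; exact Entries.search_init h0 h1 h2
  · rintro _ ⟨f, h, j, dup, g, ok, m, r, E, e, rfl, hs⟩ hb
    have hb : e < m := hb
    refine Runs.mono (runs_extendAll _ ?_ ?_ ?_) le_rfl ?_
    · exact hM
    · exact hs
    · exact hb
    rintro _ ⟨f', h', j', dup', g', ok', m', r', E', rfl, hs'⟩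
    refine ⟨⟨f', h', j', dup', g', ok', m', r', E', e + 1, rfl, hs'⟩, ?_⟩
    show M - (e + 1) < M - e
    have := hM _ _ _ hs
    omega
  · rintro _ ⟨f, h, j, dup, g, ok, m, r, E, e, rfl, hs⟩ hb
    have hb : ¬ e < m := hb
    obtain rfl : e = m := by have := hs.le; omega
    exact ⟨f, h, j, dup, g, ok, e, r, E, e, rfl, hs⟩
  · simp only [ltTest, Test.cost, NExpr.cost, he, Nat.sub_zero]
    have : 220 ≤ (M + 4) * (220 * (v.w + 1)) := by nlinarith
    generalize (M + 4) * (220 * (v.w + 1)) = X at *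
    nlinarith

/-- Mark the points of the records on the way from the last entry to the root. -/
def writeOutput : Prog :=
  .seq (.setN 12 (.sub (.var 8) (.lit 1)))
    (.loop (ltTest (.lit 0) (.var 12))
      (.seq (.setNCell 0 (.cell 1 (.cell 6 (.var 12))) (.lit 1)) (.setN 12 (.cell 5 (.var 12)))))

/-- Invariant: the points already marked together with those on the remaining path are always the
points of the whole path. -/
theorem runs_writeOutput (v : Vars) (ht : v.E.Tree v.V v.m) (hm : 0 < v.m)
    (hout : ∀ i, v.out i = 0) :
    Runs writeOutput v (fun u => ∀ i, u.out i ≠ 0 ↔ ∃ s ∈ v.E.path (v.m - 1), v.d.I s = i)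
      (20 * (v.m + 1)) := by
  refine Runs.mono_time (Runs.setN_seq (st_setN_f _ (v.m - 1))
    (Runs.loop (T := 12) (fun u => ∃ f out, u = { v with f := f, out := out } ∧ f < v.m ∧
      ∀ i, (out i ≠ 0 ∨ ∃ s ∈ v.E.path f, v.d.I s = i) ↔
        ∃ s ∈ v.E.path (v.m - 1), v.d.I s = i) (fun u => u.f)
      ⟨v.m - 1, v.out, rfl, by omega, by simp [hout]⟩ ?_ ?_)) ?_
  · rintro _ ⟨f, out, rfl, hf, hiff⟩ hb
    have hb : 0 < f := hb
    refine Runs.mono_time (Runs.setNCell_seq (st_setNCell_out _ (v.d.I (v.E.lab f)) 1)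
      (Runs.setN (st_setN_f _ (v.E.par f)) ⟨⟨v.E.par f, _, rfl, ?_, fun i => ?_⟩, ?_⟩)) ?_
    · exact (ht.par_lt f hb hf).trans hf
    · rw [← hiff i, ht.path_eq hb hf]
      rcases eq_or_ne i (v.d.I (v.E.lab f)) with rfl | hi
      · simp
      · simp [Function.update_of_ne hi, hi.symm]
    · exact ht.par_lt f hb hf
    · simp [NExpr.cost]
  · rintro _ ⟨f, out, rfl, hf, hiff⟩ hb i
    have hb : ¬ 0 < f := hb
    obtain rfl : f = 0 := by omega
    rw [← hiff i, ht.path_zero]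
    simp
  · simp only [ltTest, Test.cost, NExpr.cost]
    omega

/-! ### Preprocessing: window width and table of records. -/

/-- Compute `k = ⌈1 / ε⌉` and `w = 18 * k + 1`. -/
def setWidth : Prog :=
  .seq (.setR 1 (.lit 1))
  (.seq (.setN 1 (.lit 19))
    (.loop (.not (.rle (.lit 1) (.mul (.var 1) (.var 0))))
      (.seq (.setR 1 (.add (.var 1) (.lit 1))) (.setN 1 (.add (.var 1) (.lit 18))))))

/-- Without division or rounding the ceiling is found by counting up until `1 ≤ k * ε`; `k` as a
real and `w` as a natural number advance in lockstep. -/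
theorem runs_setWidth (v : Vars) (heps : 0 < v.eps) :
    Runs setWidth v (fun u => u = { v with w := 18 * ⌈1 / v.eps⌉₊ + 1, d.k := (⌈1 / v.eps⌉₊ : ℕ) })
      (20 * (⌈1 / v.eps⌉₊ + 1)) := by
  have hN : 1 ≤ ⌈1 / v.eps⌉₊ := Nat.one_le_iff_ne_zero.2 (Nat.ceil_pos.2 (by positivity)).ne'
  have hguard : ∀ K : ℕ, (Test.not (.rle (.lit 1) (.mul (.var 1) (.var 0)))).holds
      (st { v with w := 18 * K + 1, d.k := (K : ℕ) }) ↔ K < ⌈1 / v.eps⌉₊ := by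
    intro K
    have h1 : ((1 : ℤ) : ℝ) = 1 := by norm_num
    rw [Nat.lt_ceil, lt_div_iff₀ heps]
    simp only [Test.holds, RExpr.eval, h1, not_le]
    exact Iff.rfl
  refine Runs.mono_time (Runs.setR_seq (u := { v with d.k := (1 : ℕ) }) ?_
    (Runs.setN_seq (st_setN_w _ 19) (Runs.loop (T := 8)
      (fun u => ∃ K : ℕ, u = { v with w := 18 * K + 1, d.k := (K : ℕ) } ∧ K ≤ ⌈1 / v.eps⌉₊)
      -- Since `w = 18 * K + 1`, the quotient `w / 18` recovers the counter as a natural number.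
      (fun u => ⌈1 / v.eps⌉₊ - u.w / 18) ⟨1, rfl, hN⟩ ?_ ?_))) ?_
  · simp only [RExpr.eval, Int.cast_one, Nat.cast_one]
    exact st_setR_k _ _
  · rintro _ ⟨K, rfl, hK⟩ hb
    rw [hguard] at hb
    refine Runs.mono_time (Runs.setR_seq (u := { v with w := 18 * K + 1, d.k := (K + 1 : ℕ) }) ?_
      (Runs.setN (st_setN_w _ (18 * K + 1 + 18)) ⟨⟨K + 1, rfl, hb⟩, ?_⟩)) ?_
    · simp only [RExpr.eval, Int.cast_one, Nat.cast_add, Nat.cast_one]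
      exact st_setR_k _ _
    · show ⌈1 / v.eps⌉₊ - (18 * K + 1 + 18) / 18 < ⌈1 / v.eps⌉₊ - (18 * K + 1) / 18
      omega
    · simp [NExpr.cost, RExpr.cost]
  · rintro _ ⟨K, rfl, hK⟩ hb
    rw [hguard] at hb
    obtain rfl : K = ⌈1 / v.eps⌉₊ := by omega
    rfl
  · simp only [Test.cost, NExpr.cost, RExpr.cost]
    omega

/-- Propagate carries in the counter with digits `i`, `a`, `b`, `c` to base `n`. -/
def carry : Prog :=
  .cond (.nle (.var 0) (.var 2))
    (.seq (.setN 2 (.lit 0)) (.seq (.setN 3 (.add (.var 3) (.lit 1)))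
      (.cond (.nle (.var 0) (.var 3))
        (.seq (.setN 3 (.lit 0)) (.seq (.setN 4 (.add (.var 4) (.lit 1)))
          (.cond (.nle (.var 0) (.var 4))
            (.seq (.setN 4 (.lit 0)) (.setN 5 (.add (.var 5) (.lit 1))))
            .skip)))
        .skip)))
    .skip

/-- A carry preserves the value of the counter. Overflow shows as `c = 2` with all other digits
zero, which pins the final value to `2n³`. -/
theorem runs_carry (v : Vars) (hn : 1 ≤ v.n) (hi : v.i ≤ v.n) (ha : v.a < v.n)
    (hb : v.b < v.n) (hc : v.c < 2) :
    Runs carry v (fun u => ∃ i a b c, u = { v with i := i, a := a, b := b, c := c } ∧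
      i < v.n ∧ a < v.n ∧ b < v.n ∧ c ≤ 2 ∧ (c = 2 → i = 0 ∧ a = 0 ∧ b = 0) ∧
      i + v.n * (a + v.n * (b + v.n * c)) = v.i + v.n * (v.a + v.n * (v.b + v.n * v.c))) 50 := by
  refine Runs.mono_time (Runs.cond (T := 40) (fun h => ?_) (fun h => ?_)) (by
    simp [Test.cost, NExpr.cost])
  swap
  · have h : ¬ v.n ≤ v.i := h
    exact (Runs.skip ⟨v.i, v.a, v.b, v.c, rfl, by omega, ha, hb, by omega, by omega,
      rfl⟩).mono_time (by omega)
  have h : v.n ≤ v.i := h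
  have hvi : v.i = v.n := by omega
  refine Runs.mono_time (Runs.setN_seq (st_setN_i _ 0) (Runs.setN_seq (st_setN_a _ (v.a + 1))
    (Runs.cond (T := 20) (fun h => ?_) (fun h => ?_)))) (by simp [Test.cost, NExpr.cost])
  swap
  · have h : ¬ v.n ≤ v.a + 1 := h
    refine (Runs.skip ⟨0, v.a + 1, v.b, v.c, rfl, by omega, by omega, hb, by omega, by omega,
      ?_⟩).mono_time (by omega)
    rw [hvi]; ring
  have h : v.n ≤ v.a + 1 := h
  have hva : v.a + 1 = v.n := by omega
  refine Runs.mono_time (Runs.setN_seq (st_setN_a _ 0) (Runs.setN_seq (st_setN_b _ (v.b + 1))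
    (Runs.cond (T := 6) (fun h => ?_) (fun h => ?_)))) (by simp [Test.cost, NExpr.cost])
  swap
  · have h : ¬ v.n ≤ v.b + 1 := h
    refine (Runs.skip ⟨0, 0, v.b + 1, v.c, rfl, by omega, by omega, by omega, by omega, by omega,
      ?_⟩).mono_time (by omega)
    calc _ = v.n * (v.n + v.n * (v.b + v.n * v.c)) := by ring
      _ = v.n * (v.a + 1 + v.n * (v.b + v.n * v.c)) := by rw [hva]
      _ = _ := by rw [hvi]; ring
  have h : v.n ≤ v.b + 1 := h
  have hvb : v.b + 1 = v.n := by omega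
  refine Runs.mono_time (Runs.setN_seq (st_setN_b _ 0) (Runs.setN (st_setN_c _ (v.c + 1))
    ⟨0, 0, 0, v.c + 1, rfl, by omega, by omega, by omega, by omega, by omega, ?_⟩)) (by
      simp [NExpr.cost])
  calc _ = v.n * (v.n + v.n * (v.n - 1 + v.n * v.c)) := by rw [← hvb, Nat.add_sub_cancel]; ring
    _ = v.n * (v.a + 1 + v.n * (v.b + v.n * v.c)) := by rw [hva, ← hvb, Nat.add_sub_cancel]
    _ = _ := by rw [hvi]; ring

/-- List all records. -/
def buildTable : Prog :=
  .loop (.nle (.var 5) (.lit 1))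
    (.seq (.setN 6 (.add (.var 6) (.lit 1)))
    (.seq (.setNCell 1 (.var 6) (.var 2))
    (.seq (.setNCell 2 (.var 6) (.var 3))
    (.seq (.setNCell 3 (.var 6) (.var 4))
    (.seq (.setNCell 4 (.var 6) (.var 5))
    (.seq (.setN 2 (.add (.var 2) (.lit 1))) carry))))))

/-- `V` always equals the value of the counter, so record `r` holds the digits of `r - 1`; the label
`0` stays reserved for the root. Counting replaces the multiplication of naturals that the machine
does not have. -/
theorem runs_buildTable (v : Vars) (hn : 1 ≤ v.n) (hi : v.i = 0) (ha : v.a = 0) (hb : v.b = 0)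
    (hc : v.c = 0) (hV : v.V = 0) :
    Runs buildTable v (fun u => ∃ i a b c V I A B C,
      u = { v with i := i, a := a, b := b, c := c, V := V,
                   d := { v.d with I := I, A := A, B := B, C := C } } ∧
      V = 2 * (v.n * v.n * v.n) ∧ ∀ r, 1 ≤ r → r ≤ V →
        I r < v.n ∧ A r < v.n ∧ B r < v.n ∧ C r < 2 ∧
          r = I r + v.n * (A r + v.n * (B r + v.n * C r)) + 1)
      (100 * (2 * (v.n * v.n * v.n) + 1)) := by
  refine Runs.mono_time (Runs.loop (T := 90) (fun u => ∃ i a b c V I A B C,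
      u = { v with i := i, a := a, b := b, c := c, V := V,
                   d := { v.d with I := I, A := A, B := B, C := C } } ∧
      i < v.n ∧ a < v.n ∧ b < v.n ∧ c ≤ 2 ∧ (c = 2 → i = 0 ∧ a = 0 ∧ b = 0) ∧
      V = i + v.n * (a + v.n * (b + v.n * c)) ∧ ∀ r, 1 ≤ r → r ≤ V →
        I r < v.n ∧ A r < v.n ∧ B r < v.n ∧ C r < 2 ∧
          r = I r + v.n * (A r + v.n * (B r + v.n * C r)) + 1)
      (fun u => 2 * (v.n * v.n * v.n) - u.V)
    ⟨v.i, v.a, v.b, v.c, v.V, v.d.I, v.d.A, v.d.B, v.d.C, rfl, by omega, by omega, by omega,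
      by omega, by omega, by simp [hi, ha, hb, hc, hV], by omega⟩ ?_ ?_) ?_
  · rintro _ ⟨i, a, b, c, V, I, A, B, C, rfl, hi, ha, hb, -, -, hV, hr⟩ hcond
    have hcond : c ≤ 1 := hcond
    refine Runs.mono_time (Runs.setN_seq (st_setN_V _ (V + 1))
      (Runs.setNCell_seq (st_setNCell_I _ (V + 1) i)
      (Runs.setNCell_seq (st_setNCell_A _ (V + 1) a)
      (Runs.setNCell_seq (st_setNCell_B _ (V + 1) b)
      (Runs.setNCell_seq (st_setNCell_C _ (V + 1) c)
      (Runs.setN_seq (st_setN_i _ (i + 1))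
      (Runs.mono (runs_carry _ ?_ ?_ ?_ ?_ ?_) le_rfl ?_))))))) ?_
    · exact hn
    · exact hi
    · exact ha
    · exact hb
    · exact Nat.lt_succ_of_le hcond
    · rintro _ ⟨i', a', b', c', rfl, hi', ha', hb', hc', hc2', hval⟩
      dsimp only at hval hi' ha' hb'
      refine ⟨⟨i', a', b', c', V + 1, Function.update I (V + 1) i, Function.update A (V + 1) a,
        Function.update B (V + 1) b, Function.update C (V + 1) c, rfl, hi', ha', hb', hc', hc2',
        by omega, ?_⟩, ?_⟩
      · intro r hr1 hrV
        rcases Nat.lt_succ_iff_lt_or_eq.1 (Nat.lt_succ_of_le hrV) with hlt | rfl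
        · simp only [Function.update_of_ne hlt.ne]
          exact hr r hr1 (by omega)
        · simp only [Function.update_self]
          exact ⟨hi, ha, hb, by omega, by omega⟩
      · show 2 * (v.n * v.n * v.n) - (V + 1) < 2 * (v.n * v.n * v.n) - V
        have : V < 2 * (v.n * v.n * v.n) := by
          have h1 : b + v.n * c + 1 ≤ v.n * 2 := by nlinarith
          have h2 : a + v.n * (b + v.n * c) + 1 ≤ v.n * (v.n * 2) := by nlinarith
          nlinarith
        omega
    · simp [NExpr.cost]
  · rintro _ ⟨i, a, b, c, V, I, A, B, C, rfl, hi, ha, hb, hc, hc2, hV, hr⟩ hcond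
    have hcond : ¬ c ≤ 1 := hcond
    obtain rfl : c = 2 := by omega
    obtain ⟨rfl, rfl, rfl⟩ := hc2 rfl
    exact ⟨0, 0, 0, 2, V, I, A, B, C, rfl, by rw [hV]; ring, hr⟩
  · simp only [Test.cost, NExpr.cost, hV]
    omega

/-- Digits are determined by the value. -/
theorem digits_unique {n i a b c i' a' b' c' : ℕ} (hi : i < n) (ha : a < n) (hb : b < n)
    (hi' : i' < n) (ha' : a' < n) (hb' : b' < n)
    (h : i + n * (a + n * (b + n * c)) = i' + n * (a' + n * (b' + n * c'))) :
    i = i' ∧ a = a' ∧ b = b' ∧ c = c' := by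
  have key : ∀ {x y x' y' : ℕ}, x < n → x' < n → x + n * y = x' + n * y' → x = x' ∧ y = y' := by
    intro x y x' y' hx hx' h
    have h1 : x = x' := by
      simpa [Nat.add_mul_mod_self_left, Nat.mod_eq_of_lt hx, Nat.mod_eq_of_lt hx'] using
        congrArg (· % n) h
    subst h1
    exact ⟨rfl, Nat.eq_of_mul_eq_mul_left (by omega) (Nat.add_left_cancel h)⟩
  obtain ⟨h1, h⟩ := key hi hi' h
  obtain ⟨h2, h⟩ := key ha ha' h
  obtain ⟨h3, h⟩ := key hb hb' h
  exact ⟨h1, h2, h3, h⟩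

/-! ### Correctness of the whole search. -/

/-- The values of the variables at the start. -/
noncomputable def initVars (ε : ℝ) {n : ℕ} (c : Fin n → EuclideanSpace ℝ (Fin 2)) : Vars where
  n := n
  w := 0
  i := 0
  a := 0
  b := 0
  c := 0
  V := 0
  e := 0
  m := 0
  r := 0
  ok := 0
  j := 0
  f := 0
  g := 0
  h := 0
  dup := 0
  out := fun _ => 0
  E := ⟨fun _ => 0, fun _ => 0, fun _ => 0⟩
  d :=
    { x := fun i => if h : i < n then c ⟨i, h⟩ 0 else 0
      y := fun i => if h : i < n then c ⟨i, h⟩ 1 else 0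
      I := fun _ => 0
      A := fun _ => 0
      B := fun _ => 0
      C := fun _ => 0
      k := 0 }
  eps := ε

theorem st_initVars (ε : ℝ) {n : ℕ} (c : Fin n → EuclideanSpace ℝ (Fin 2)) :
    st (initVars ε c) = input ε c := by
  apply State.ext
  · funext x
    simp only [st, initVars, input]
    split <;> simp_all
  · funext A i
    simp only [st, initVars, input]
    split <;> rfl
  · funext x
    simp only [st, initVars, input]
    split <;> simp_all
  · funext A i
    simp only [st, initVars, input]
    split <;> simp_all

/-- The search for a longest window-valid list of records. -/
def windowSearch : Prog := .seq setWidth (.seq buildTable (.seq search writeOutput))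

theorem runs_windowSearch {ε : ℝ} (hε : 0 < ε) {n : ℕ} (hn : 1 ≤ n)
    (c : Fin n → EuclideanSpace ℝ (Fin 2)) {K w V M : ℕ} (hK : K = ⌈1 / ε⌉₊)
    (hw : w = 18 * K + 1) (hV : V = 2 * (n * n * n)) (hM : M = (n + 1) * (V + 1) ^ w) :
    Runs windowSearch (initVars ε c) (fun u => IsApprox c (1 + ε) (output n (st u)))
      (20 * (K + 1) + (100 * (V + 1) +
        ((M + 1) * ((V + 2) * ((M + 4) * (220 * (w + 1)))) + 20 * (M + 1)))) := by
  have hKpos : 1 ≤ K := by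
    rw [hK]; exact Nat.one_le_iff_ne_zero.2 (Nat.ceil_pos.2 (by positivity)).ne'
  have hKε : 1 ≤ K * ε := by
    have := Nat.le_ceil (1 / ε)
    rw [← hK, div_le_iff₀ hε] at this
    exact this
  refine Runs.seq (P := fun u => u = { initVars ε c with w := w, d.k := (K : ℕ) }) ?_ ?_
  · subst hw hK
    exact runs_setWidth _ hε
  rintro _ rfl
  refine Runs.seq (Runs.mono (runs_buildTable _ hn rfl rfl rfl rfl rfl)
    (T' := 100 * (V + 1)) (by rw [hV]; exact le_rfl) fun _ => id) ?_
  rintro _ ⟨i, a, b, q, V', I, A, B, C, rfl, hV', hrec⟩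
  obtain rfl : V' = V := hV'.trans hV.symm
  dsimp only [initVars] at hrec
  set D : Table := { (initVars ε c).d with I := I, A := A, B := B, C := C, k := (K : ℕ) } with hD
  have hk : D.k = K := rfl
  have hx : ∀ i : Fin n, D.x i = c i 0 := fun i => dif_pos i.2
  have hy : ∀ i : Fin n, D.y i = c i 1 := fun i => dif_pos i.2
  -- The packing bound needs `12K + 6 < 18K + 1`, which holds because `K ≥ 1`.
  have hsound : ∀ {l : List ℕ}, WindowValid D.Fit D.Prec w l → (∀ r ∈ l, 1 ≤ r ∧ r ≤ V') →
      ∀ {S : Finset (Fin n)}, (∀ i : Fin n, i ∈ S ↔ ∃ r ∈ l, D.I r = i) →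
        IsFeasible c S ∧ S.card = l.length := fun {l} hl hlV {S} hS =>
    isFeasible_of_windowValid hk hx hy (by omega) hl
      (fun r hr => (hrec r (hlV r hr).1 (hlV r hr).2).1)
      (fun r hr => (hrec r (hlV r hr).1 (hlV r hr).2).2.2.2.1) hS
  -- Every stored path names distinct disks, so lengths never exceed `n`; this caps the number of
  -- entries.
  have hbound : ∀ E m e, Entries.Search D.Fit D.Prec E w V' m e → m ≤ M := by
    intro E m e hs
    rw [hM]
    refine hs.card_le fun f hf => ?_
    classical
    have := (hsound (hs.valid f hf) (hs.tree.forall_mem_path hf)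
      (S := Finset.univ.filter fun i : Fin n => ∃ r ∈ E.path f, D.I r = i) (by simp)).2
    rw [← E.length_path f, ← this]
    simpa using Finset.card_le_univ (Finset.univ.filter fun i : Fin n => ∃ r ∈ E.path f, D.I r = i)
  refine Runs.seq (runs_search _ (M := M) hbound rfl rfl rfl rfl) ?_
  rintro _ ⟨f, h, j, dup, g, ok, m, r, E, e, rfl, hs⟩
  refine Runs.mono (runs_writeOutput _ hs.tree hs.pos fun _ => rfl)
    (Nat.mul_le_mul_left _ (Nat.add_le_add_right (hbound _ _ _ hs) 1)) ?_
  intro u hu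
  have hlast : m - 1 < m := by have := hs.pos; omega
  obtain ⟨hfeas, hcard⟩ := hsound (hs.valid _ hlast) (hs.tree.forall_mem_path hlast)
    (S := output n (st u)) fun i => by
      rw [output, Finset.mem_filter]
      exact (and_iff_right (Finset.mem_univ i)).trans (hu i)
  refine ⟨hfeas, fun T hT => ?_⟩
  -- The record with given digits is found at the value of these digits plus one.
  obtain ⟨l, hl, hlV, hlen⟩ := exists_windowValid hk hx hy (V := V') (by
    intro i hi a ha b hb q hq
    have hle : i + n * (a + n * (b + n * q)) + 1 ≤ V' := by
      have h1 : b + n * q + 1 ≤ n * 2 := by nlinarith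
      have h2 : a + n * (b + n * q) + 1 ≤ n * (n * 2) := by nlinarith
      nlinarith
    obtain ⟨h1, h2, h3, h4, h5⟩ := hrec _ (Nat.succ_le_succ (Nat.zero_le _)) hle
    exact ⟨_, Nat.succ_le_succ (Nat.zero_le _), hle,
      digits_unique h1 h2 h3 hi ha hb (Nat.succ_injective h5).symm⟩) hT w
  have hle := hs.length_le hl hlV
  rw [← E.length_path, ← hcard] at hle
  have hmain : (K : ℝ) * T.card ≤ (K + 1) * (output n (st u)).card := by
    exact_mod_cast hlen.trans (Nat.mul_le_mul_left _ hle)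
  have hS : (0 : ℝ) ≤ (output n (st u)).card := Nat.cast_nonneg _
  -- From `K|T| ≤ (K + 1)|S|` and `1 ≤ Kε`, after scaling the goal by `K`.
  refine le_of_mul_le_mul_left (a := (K : ℝ)) ?_ (by exact_mod_cast hKpos)
  nlinarith

/-! ### Running time and the final statement. -/

/-- The algorithm. -/
def algorithm : Prog :=
  .cond (.nle (.var 0) (.lit 1)) (.setNCell 0 (.lit 0) (.lit 1)) windowSearch

theorem isApprox_of_le_one {n : ℕ} (hn : n ≤ 1) (c : Fin n → EuclideanSpace ℝ (Fin 2)) {ε : ℝ}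
    (hε : 0 < ε) : IsApprox c (1 + ε) Finset.univ := by
  have : Subsingleton (Fin n) := Fin.subsingleton_iff_le_one.2 hn
  refine ⟨(isFeasible_iff c _).2
    ⟨fun _ => 0, fun i _ j _ hij => absurd (Subsingleton.elim i j) hij⟩, fun T _ => ?_⟩
  have h1 : (T.card : ℝ) ≤ (Finset.univ : Finset (Fin n)).card := by
    exact_mod_cast Finset.card_le_univ T
  have h2 : (0 : ℝ) ≤ (Finset.univ : Finset (Fin n)).card := Nat.cast_nonneg _
  nlinarith

/-- Every factor is at most a constant times `Z = n ^ (5w + 2)`: `n ≥ 2` gives `V + 1 ≤ n⁵`, `n + 1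
≤ n²` and `w ≤ n ^ w`. The dominant product has four factors of this size, and `4(5(18K + 1) + 2) =
360K + 28`. -/
theorem time_le {n K w V M : ℕ} (hn : 2 ≤ n) (hw : w = 18 * K + 1) (hV : V = 2 * (n * n * n))
    (hM : M = (n + 1) * (V + 1) ^ w) :
    20 * (K + 1) + (100 * (V + 1) +
        ((M + 1) * ((V + 2) * ((M + 4) * (220 * (w + 1)))) + 20 * (M + 1))) + 10 ≤
      20000 * n ^ (360 * K + 28) := by
  set Z := n ^ (5 * w + 2) with hZ
  have hn0 : 0 < n := by omega
  have hZ1 : 1 ≤ Z := Nat.one_le_pow _ _ hn0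
  have hpow : ∀ {p}, p ≤ 5 * w + 2 → n ^ p ≤ Z := fun hp => Nat.pow_le_pow_right hn0 hp
  have hwZ : w ≤ Z := (Nat.lt_pow_self (by omega : 1 < n)).le.trans (hpow (by omega))
  have hV5 : V + 1 ≤ n ^ 5 := by
    have h1 : V ≤ n ^ 4 := by
      rw [hV]; calc 2 * (n * n * n) ≤ n * (n * n * n) := Nat.mul_le_mul_right _ hn
        _ = n ^ 4 := by ring
    have h2 : 1 ≤ n ^ 4 := Nat.one_le_pow _ _ hn0
    calc V + 1 ≤ 2 * n ^ 4 := by omega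
      _ ≤ n * n ^ 4 := Nat.mul_le_mul_right _ hn
      _ = n ^ 5 := by ring
  have hVZ : V + 1 ≤ Z := hV5.trans (hpow (by omega))
  have hMZ : M ≤ Z := by
    rw [hM, hZ, pow_add, mul_comm, pow_mul]
    exact Nat.mul_le_mul (Nat.pow_le_pow_left hV5 w) (by nlinarith)
  have hKZ : K + 1 ≤ 2 * Z := by omega
  have hZ4 : n ^ (360 * K + 28) = Z ^ 4 := by
    rw [hZ, ← pow_mul, hw]; congr 1; ring
  have hZZ : Z ≤ Z ^ 4 := Nat.le_self_pow (by norm_num) Z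
  have hprod : (M + 1) * ((V + 2) * ((M + 4) * (220 * (w + 1)))) ≤
      (2 * Z) * ((2 * Z) * ((5 * Z) * (220 * (2 * Z)))) := by
    gcongr <;> omega
  have hprod' : (2 * Z) * ((2 * Z) * ((5 * Z) * (220 * (2 * Z)))) = 8800 * Z ^ 4 := by ring
  rw [hZ4]
  omega

end MBS

theorem mainTheorem2 :
    ∃ (P : RealRAM.Prog) (C a b : ℕ),
      ∀ (ε : ℝ), 0 < ε → ∀ (n : ℕ) (c : Fin n → EuclideanSpace ℝ (Fin 2)),
        ∃ (τ : RealRAM.State) (t : ℕ),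
          RealRAM.Exec P (MBS.input ε c) τ t ∧
          (t : ℝ) ≤ C * (((max n 1 : ℕ) : ℝ) ^ (a : ℝ) * ((max n 1 : ℕ) : ℝ) ^ ((b : ℝ) / ε)) ∧
          MBS.IsApprox c (1 + ε) (MBS.output n τ) := by
  -- The exponent `388 = 28 + 360` absorbs the rounding `⌈1/ε⌉ < 1/ε + 1`.
  refine ⟨MBS.algorithm, 20000, 388, 360, fun ε hε n c => ?_⟩
  -- For `n ≤ 1` the allowed time is a constant, which even the computation of `⌈1/ε⌉` would exceed
  -- for small `ε`; such inputs bypass the search.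
  rcases Nat.lt_or_ge 1 n with hn | hn
  · obtain ⟨u, t, hexec, ht, happrox⟩ :=
      MBS.runs_windowSearch hε hn.le c rfl rfl rfl rfl
    have htime := MBS.time_le (K := ⌈1 / ε⌉₊) hn rfl rfl rfl
    refine ⟨MBS.st u, _, RealRAM.Exec.cond_false ?_ (MBS.st_initVars ε c ▸ hexec), ?_, happrox⟩
    · show ¬ n ≤ 1
      omega
    · rw [max_eq_left hn.le]
      have hn1 : (1 : ℝ) ≤ n := by exact_mod_cast hn.le
      have hle : (RealRAM.Test.nle (.var 0) (.lit 1)).cost + t + 1 ≤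
          20000 * n ^ (360 * ⌈1 / ε⌉₊ + 28) := by
        simp only [RealRAM.Test.cost, RealRAM.NExpr.cost]
        omega
      calc (((RealRAM.Test.nle (.var 0) (.lit 1)).cost + t + 1 : ℕ) : ℝ)
          ≤ 20000 * (n : ℝ) ^ (360 * ⌈1 / ε⌉₊ + 28) := by exact_mod_cast hle
        _ = 20000 * (n : ℝ) ^ ((360 * ⌈1 / ε⌉₊ + 28 : ℕ) : ℝ) := by rw [Real.rpow_natCast]
        _ ≤ 20000 * (n : ℝ) ^ ((388 : ℝ) + 360 / ε) := by
          gcongr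
          have := Nat.ceil_lt_add_one (a := 1 / ε) (by positivity)
          have h2 : (360 : ℝ) / ε = 360 * (1 / ε) := by ring
          push_cast
          rw [h2]
          linarith
        _ = _ := by
          rw [Real.rpow_add (by linarith)]
          norm_num
  -- Marking cell 0 selects the only disk when `n = 1` and has no effect on the output when `n = 0`.
  · refine ⟨_, _, RealRAM.Exec.cond_true ?_ (RealRAM.Exec.setNCell _ _ _ _), ?_, ?_⟩
    · show n ≤ 1
      exact hn
    · rw [max_eq_right hn]
      norm_num [RealRAM.Test.cost, RealRAM.NExpr.cost]
    · convert MBS.isApprox_of_le_one hn c hε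
      rw [Finset.eq_univ_iff_forall]
      intro i
      have hi : (i : ℕ) = 0 := by omega
      simp [MBS.output, RealRAM.State.setNCell, RealRAM.NExpr.eval, hi]
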